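/- Let $\mathbb{D}=\{z\in\mathbb{C}:|z|<1\}$, $\mathbb{T}=\{z\in\mathbb C:|z|=1\}$, and equip the Riemann sphere $\hat{\mathbb{C}}=\mathbb{C}\cup\{\infty\}$ with the spherical metric $|dz|/(1+|z|^2)$. A domain $\Omega\subset\hat{\mathbb{C}}$ is called spherically convex if for any two points $a,b\in\Omega$ that are not antipodal the spherical geodesic joining $a$ and $b$ (the smaller arc of the great circle through $a$ and $b$) lies in $\Omega$. A meromorphic univalent function $f:\mathbb{D}\to\hat{\mathbb{C}}$ is called spherically convex if $f(\mathbb{D})$ is a spherically convex domain. It is called a spherical isometry if it is the restriction to $\mathbb{D}$ of a rotation of the sphere, that is, of a map $z\mapsto e^{i\theta}\frac{z-a}{1+z\overline{a}}$ with $a\in\mathbb{C}$, $\theta\in\mathbb{R}$, or $z\mapsto e^{i\theta}/z$ with $\theta\in\mathbb{R}$. The spherical derivative of $f$ is $f^{\sharp}(z)=\frac{|f'(z)|}{1+|f(z)|^2}$ (at a pole of $f$, computed with $1/f$ in place of $f$), and for $0<r<1$ the spherical lengths of $f(r\mathbb{T})$ and of $r\mathbb{T}$ are $$L_s f(r\mathbb{T})=\int_{|z|=r}f^{\sharp}(z)\,|dz|,\qquad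 L_s(r\mathbb{T})=\int_{|z|=r}\frac{|dz|}{1+|z|^2}=\frac{2\pi r}{1+r^2}.$$ **Theorem (Length Schwarz's lemma for spherically convex functions).** Let $f:\mathbb{D}\to\hat{\mathbb{C}}$ be a spherically convex function. Then $$L_s f(r\mathbb{T})\ \ge\ L_s(r\mathbb{T})\,f^{\sharp}(0)\qquad\text{for every } 0<r<1.$$ Moreover, for each $0<r<1$, equality holds if and only if $f$ is a spherical isometry. (In particular, equality for a single $r$ already forces $f$ to be a spherical isometry, and then equality holds for every $r$.) -/

import Mathlib

open Set Filter Topology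

open scoped OnePoint ComplexConjugate

noncomputable section

namespace SphGeom

/-- The Riemann sphere `ℂ ∪ {∞}`, with the topology of the one-point compactification. -/
abbrev Sphere : Type := OnePoint ℂ

/-- The open unit disk. -/
abbrev disk : Set ℂ := Metric.ball (0 : ℂ) 1

/-- `1 / w` as a point of the sphere, with `1 / 0 = ∞`. -/
def recip (w : ℂ) : Sphere := if w = 0 then ∞ else ((w⁻¹ : ℂ) : Sphere)

/-- The chart `w ↦ w` of the sphere on `ℂ` (extended by the value `0` at `∞`). -/
def chartZero (p : Sphere) : ℂ := p.elim 0 (fun w => w)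

/-- The chart `w ↦ 1 / w`, `∞ ↦ 0` of the sphere around `∞` (extended by the value `0` at `0`). -/
def chartInfty (p : Sphere) : ℂ := p.elim 0 (fun w => w⁻¹)

/-- `f` is meromorphic on the open set `U`, as a map into the sphere: near each point of `U` either
`f = g` or `f = 1 / g`, where `g` is holomorphic and, in the second case, `g` is zero at most
at that point; `f` has the value `∞` at its poles. -/
def MeromorphicMapOn (f : ℂ → Sphere) (U : Set ℂ) : Prop :=
  ∀ z ∈ U,
    (∃ g : ℂ → ℂ, AnalyticAt ℂ g z ∧ ∀ᶠ w in 𝓝 z, f w = ((g w : ℂ) : Sphere)) ∨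
    (∃ g : ℂ → ℂ, AnalyticAt ℂ g z ∧ (∀ᶠ w in 𝓝[≠] z, g w ≠ 0) ∧
      ∀ᶠ w in 𝓝 z, f w = recip (g w))

open Classical in
/-- The spherical derivative `|f'| / (1 + |f|²)`; at a pole it is computed from `1 / f`, for which
`|(1/f)'| / (1 + |1/f|²)` is the same function off the zeros and poles of `f`. -/
def sphDeriv (f : ℂ → Sphere) (z : ℂ) : ℝ :=
  if f z = ∞ then
    ‖deriv (fun w => chartInfty (f w)) z‖ / (1 + ‖chartInfty (f z)‖ ^ 2)
  else
    ‖deriv (fun w => chartZero (f w)) z‖ / (1 + ‖chartZero (f z)‖ ^ 2)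

/-- Inverse stereographic projection onto the unit sphere of `ℝ³ = ℂ × ℝ`. Only the linear structure
of `ℂ × ℝ` is used below, not its norm. -/
def stereoInv (p : Sphere) : ℂ × ℝ :=
  p.elim (0, 1) (fun w =>
    (((2 / (1 + ‖w‖ ^ 2) : ℝ) : ℂ) * w, (‖w‖ ^ 2 - 1) / (1 + ‖w‖ ^ 2)))

/-- Antipodal points of the sphere. -/
def Antipodal (a b : Sphere) : Prop := stereoInv b = -stereoInv a

/-- For `a`, `b` not antipodal, the spherical geodesic joining `a` and `b`, that is, the smaller arc
of the great circle through `a` and `b`: on the unit sphere of `ℝ³` it consists of the points that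
lie in the cone spanned by `a` and `b`. -/
def geodesicArc (a b : Sphere) : Set Sphere :=
  {c | ∃ s t : ℝ, 0 ≤ s ∧ 0 ≤ t ∧ stereoInv c = s • stereoInv a + t • stereoInv b}

/-- Spherically convex domains of the sphere. -/
structure IsSphericallyConvexDomain (Ω : Set Sphere) : Prop where
  isOpen : IsOpen Ω
  isConnected : IsConnected Ω
  geodesic_subset : ∀ a ∈ Ω, ∀ b ∈ Ω, ¬ Antipodal a b → geodesicArc a b ⊆ Ω

/-- Spherically convex functions on the unit disk. The values of `f` off the disk are irrelevant. -/
structure IsSphericallyConvex (f : ℂ → Sphere) : Prop where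
  meromorphic : MeromorphicMapOn f disk
  injOn : InjOn f disk
  convex_image : IsSphericallyConvexDomain (f '' disk)

/-- The rotations of the sphere: the Möbius transformations `e^{iθ} (z - a) / (1 + z ā)` with
`a ∈ ℂ`, `θ ∈ ℝ`, and `e^{iθ} / z` with `θ ∈ ℝ`. -/
def rotations : Set (Sphere → Sphere) :=
  {T | ∃ M : GL (Fin 2) ℂ,
    ((∃ (a : ℂ) (θ : ℝ), (M : Matrix (Fin 2) (Fin 2) ℂ) =
        !![Complex.exp (θ * Complex.I), -(Complex.exp (θ * Complex.I) * a); conj a, 1]) ∨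
      (∃ θ : ℝ, (M : Matrix (Fin 2) (Fin 2) ℂ) = !![0, Complex.exp (θ * Complex.I); 1, 0])) ∧
    ∀ p : Sphere, T p = M • p}

/-- `f`, as a function on the unit disk, is a spherical isometry. -/
def IsSphericalIsometry (f : ℂ → Sphere) : Prop :=
  ∃ T ∈ rotations, ∀ z ∈ disk, f z = T (z : Sphere)

/-- The spherical length `∫_{|z| = r} f^♯(z) |dz|` of the image under `f` of the circle `|z| = r`. -/
def lengthImage (f : ℂ → Sphere) (r : ℝ) : ℝ :=
  ∫ t in (0 : ℝ)..(2 * Real.pi), sphDeriv f (circleMap 0 r t) * r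

/-- The spherical length `∫_{|z| = r} |dz| / (1 + |z|²)` of the circle `|z| = r`. -/
def lengthCircle (r : ℝ) : ℝ :=
  ∫ t in (0 : ℝ)..(2 * Real.pi), 1 / (1 + ‖circleMap 0 r t‖ ^ 2) * r

theorem lengthCircle_eq (r : ℝ) : lengthCircle r = 2 * Real.pi * r / (1 + r ^ 2) := by
  simp [lengthCircle]
  ring

end SphGeom

end

/-! Write f = q / p with p, q holomorphic on the disk and Wronskian p q' - p' q = 1
(`IsSphericallyConvex.exists_convexLift`). Then f^♯ = 1 / N with N = |p|² + |q|², so a lower bound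
for the length of the image circle follows from an upper bound for the mean of N over |z| = r.

Convexity enters as the pointwise curvature inequality 2 Re (z p' p̄ + z q' q̄) ≤ N
(`ConvexLift.two_mul_re_le`). Both sides are invariant under SU(2), so f(z) may be rotated to 0. The
image, a convex proper subset of the sphere, then omits ∞ and is a convex planar domain, and the
inequality becomes Study's Re (1 + z f'' / f') ≥ 0.

Let c_n = |a_n|² + |b_n|² for the Taylor coefficients of p and q. By Parseval, integrating the
inequality over |z| = s gives ∑ (1 - 2n) c_n s^{2n} ≥ 0, and s → 1 gives ∑_{n ≥ 1} (2n - 1) c_n ≤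
c_0 (`sum_range_le_of_hasSum`). Hence the mean ∑ c_n r^{2n} of N is at most (1 + r²) c_0
(`hasSum_add_le`). The harmonic–arithmetic mean inequality (`two_pi_div_le_integral_inv`) and f^♯(0)
= 1 / c_0 finish the estimate.

Equality at one r forces c_n = 0 for n ≥ 2, c_1 = c_0 and N constant on |z| = r. So p and q are
affine, their coefficients form an SU(2) matrix (`ConvexLift.eq_of_affine`), and f is a rotation. -/

noncomputable section

namespace SphGeom

/-! ### Univalent functions, local inverses and square roots -/

/-- A holomorphic function that is injective on an open set has no critical points there. -/
theorem deriv_ne_zero_of_injOn {g : ℂ → ℂ} {U : Set ℂ} (hU : IsOpen U)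
    (hg : DifferentiableOn ℂ g U) (hinj : InjOn g U) {z : ℂ} (hz : z ∈ U) : deriv g z ≠ 0 := by
  intro hd
  have hgz : AnalyticAt ℂ g z := hg.analyticAt (hU.mem_nhds hz)
  have hsub : AnalyticAt ℂ (fun w => g w - g z) z := hgz.sub analyticAt_const
  have htop : analyticOrderAt (fun w => g w - g z) z ≠ ⊤ := by
    rw [ne_eq, analyticOrderAt_eq_top]
    intro h
    obtain ⟨w, ⟨hw, hwU⟩, hwz⟩ := ((((h.and (hU.mem_nhds hz)).filter_mono
      nhdsWithin_le_nhds).and (self_mem_nhdsWithin (s := ({z}ᶜ : Set ℂ)))).exists)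
    exact hwz (hinj hwU hz (sub_eq_zero.1 hw))
  obtain ⟨n, hn⟩ := ENat.ne_top_iff_exists.1 htop
  obtain ⟨h, hh, hhz, heq⟩ := (hsub.analyticOrderAt_eq_natCast).1 hn.symm
  have hn0 : n ≠ 0 := by
    rintro rfl
    have := heq.self_of_nhds
    simp only [sub_self, pow_zero, one_smul] at this
    exact hhz this.symm
  have hn1 : n ≠ 1 := by
    rintro rfl
    have h1 : HasDerivAt (fun w => (w - z) ^ 1 • h w) (h z) z := by
      simpa using ((hasDerivAt_id' z).sub_const z).fun_mul hh.differentiableAt.hasDerivAt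
    have h2 : HasDerivAt (fun w => g w - g z) (h z) z := h1.congr_of_eventuallyEq heq
    have h3 := (hgz.differentiableAt.hasDerivAt.sub_const (g z)).unique h2
    exact hhz (by rw [← h3, hd])
  obtain ⟨c, hc⟩ := IsAlgClosed.exists_pow_nat_eq (h z) (Nat.pos_of_ne_zero hn0)
  have hc0 : c ≠ 0 := by
    rintro rfl
    exact hhz (by rw [← hc, zero_pow hn0])
  have hq : AnalyticAt ℂ (fun w => h w / h z) z := hh.div_const
  -- A local n-th root of g - g z, where n ≥ 2 is the order of vanishing. The principal logarithm is
  -- analytic near h z / h z = 1, and k has the nonzero derivative c at z.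
  set k : ℂ → ℂ := fun w => (w - z) * (c * Complex.exp (Complex.log (h w / h z) / n)) with hk
  have hroot : AnalyticAt ℂ (fun w => c * Complex.exp (Complex.log (h w / h z) / n)) z := by
    refine analyticAt_const.mul (AnalyticAt.cexp (AnalyticAt.div_const (hq.clog ?_)))
    simp [div_self hhz]
  have hkd : HasStrictDerivAt k c z := by
    have hka : AnalyticAt ℂ k z := (analyticAt_id.sub analyticAt_const).mul hroot
    have h1 : HasDerivAt k c z := by
      have := ((hasDerivAt_id' z).sub_const z).fun_mul hroot.differentiableAt.hasDerivAt
      simpa [hk, div_self hhz] using this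
    simpa [h1.deriv] using hka.hasStrictDerivAt
  have hkn : ∀ᶠ w in 𝓝 z, g w - g z = k w ^ n := by
    have hne : ∀ᶠ w in 𝓝 z, h w ≠ 0 := hh.continuousAt.eventually_ne hhz
    filter_upwards [heq, hne] with w hw hw0
    rw [hw, hk, smul_eq_mul]
    simp only [mul_pow]
    rw [hc, ← Complex.exp_nat_mul, mul_div_cancel₀ _ (by exact_mod_cast hn0),
      Complex.exp_log (div_ne_zero hw0 hhz), mul_div_cancel₀ _ hhz]
  have hS : k '' {w | w ∈ U ∧ g w - g z = k w ^ n} ∈ 𝓝 (0 : ℂ) := by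
    have := hkd.map_nhds_eq hc0
    have hkz : k z = 0 := by simp [hk]
    rw [hkz] at this
    rw [← this]
    exact image_mem_map ((hU.eventually_mem hz).and hkn)
  obtain ⟨ζ, hζ⟩ : ∃ ζ : ℂ, IsPrimitiveRoot ζ n := ⟨_, Complex.isPrimitiveRoot_exp n hn0⟩
  have hζ1 : ζ ≠ 1 := hζ.ne_one (by omega)
  have hm : ∀ᶠ t in 𝓝 (0 : ℂ), t * ζ ∈ k '' {w | w ∈ U ∧ g w - g z = k w ^ n} := by
    have : Tendsto (fun t : ℂ => t * ζ) (𝓝 0) (𝓝 0) := by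
      have h := (continuous_mul_const ζ).tendsto (0 : ℂ)
      rwa [zero_mul] at h
    exact this.eventually hS
  -- As k is open at z, both t and tζ are values of k near z for small t ≠ 0. Their n-th powers
  -- agree, so g takes the same value at two distinct points.
  obtain ⟨t, ⟨⟨a, ⟨haU, ha⟩, hat⟩, ⟨b, ⟨hbU, hb⟩, hbt⟩⟩, ht0⟩ :=
    ((((eventually_mem_set.2 hS).and hm).filter_mono nhdsWithin_le_nhds).and
      (self_mem_nhdsWithin (s := ({0}ᶜ : Set ℂ)))).exists
  have hab : a = b := by
    refine hinj haU hbU ?_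
    have : g a - g z = g b - g z := by rw [ha, hb, hat, hbt, mul_pow, hζ.pow_eq_one, mul_one]
    exact sub_left_injective this
  rw [hab, hbt] at hat
  exact hζ1 (mul_left_cancel₀ ht0 (by simpa using hat))

/-- The inverse of an injective holomorphic function is holomorphic. -/
theorem hasDerivAt_invFunOn {g : ℂ → ℂ} {U : Set ℂ} (hU : IsOpen U)
    (hg : DifferentiableOn ℂ g U) (hinj : InjOn g U) {z : ℂ} (hz : z ∈ U) :
    HasDerivAt (Function.invFunOn g U) (deriv g z)⁻¹ (g z) := by
  have hd := deriv_ne_zero_of_injOn hU hg hinj hz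
  have hgz : AnalyticAt ℂ g z := hg.analyticAt (hU.mem_nhds hz)
  have hmap := hgz.hasStrictDerivAt.map_nhds_eq hd
  have hleft : ∀ w ∈ U, Function.invFunOn g U (g w) = w := fun w hw => hinj.leftInvOn_invFunOn hw
  have himg : g '' U ∈ 𝓝 (g z) := by
    rw [← hmap]
    exact image_mem_map (hU.mem_nhds hz)
  refine HasDerivAt.of_local_left_inverse (f := g) ?_ ?_ hd ?_
  · rw [ContinuousAt, ← hmap, tendsto_map'_iff, hleft z hz]
    refine tendsto_id.congr' ?_
    filter_upwards [hU.mem_nhds hz] with w hw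
    exact (hleft w hw).symm
  · rw [hleft z hz]
    exact hgz.differentiableAt.hasDerivAt
  · filter_upwards [himg] with y hy
    exact Function.invFunOn_eq hy

/-- A zero-free holomorphic function on the disk has a holomorphic square root. -/
theorem exists_sqrt {g : ℂ → ℂ} (hg : DifferentiableOn ℂ g disk) (h0 : ∀ z ∈ disk, g z ≠ 0) :
    ∃ s : ℂ → ℂ, DifferentiableOn ℂ s disk ∧ ∀ z ∈ disk, s z ^ 2 = g z := by
  have hg' : DifferentiableOn ℂ (fun z => deriv g z / g z) disk :=
    (hg.deriv Metric.isOpen_ball).div hg h0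
  -- A logarithm of g, as a primitive of g' / g; `exp (l / 2)` is then the square root.
  obtain ⟨l, hl0, hl⟩ := hg'.isExactOn_ball.with_val_at 0 (Complex.log (g 0))
  have hz0 : (0 : ℂ) ∈ disk := by simp
  have hconst : ∀ z ∈ disk, g z * Complex.exp (-l z) = 1 := by
    have hder : ∀ z ∈ disk, HasDerivAt (fun z => g z * Complex.exp (-l z)) 0 z := by
      intro z hz
      have h1 := (hg.differentiableAt (Metric.isOpen_ball.mem_nhds hz)).hasDerivAt
      have h2 := h1.mul (hl z hz).neg.cexp
      convert! h2 using 1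
      field_simp [h0 z hz]
      ring
    intro z hz
    have := (convex_ball (0 : ℂ) 1).is_const_of_fderivWithin_eq_zero (𝕜 := ℂ)
      (f := fun z => g z * Complex.exp (-l z))
      (fun z hz => (hder z hz).differentiableAt.differentiableWithinAt)
      (fun z hz => by
        rw [fderivWithin_of_isOpen Metric.isOpen_ball hz]
        ext
        simp [(hder z hz).deriv]) hz hz0
    rw [this, hl0, Complex.exp_neg, Complex.exp_log (h0 0 hz0), mul_inv_cancel₀ (h0 0 hz0)]
  refine ⟨fun z => Complex.exp (l z / 2), fun z hz =>
    ((hl z hz).differentiableAt.div_const 2).cexp.differentiableWithinAt, fun z hz => ?_⟩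
  rw [← Complex.exp_nat_mul]
  have h1 := hconst z hz
  rw [Complex.exp_neg, mul_inv_eq_one₀ (Complex.exp_ne_zero _)] at h1
  rw [h1]
  congr 1
  push_cast
  ring

/-! ### Fourier analysis on circles and Taylor expansions -/

/-- Orthogonality of the monomials on circles centred at the origin. -/
theorem integral_circleMap_pow_mul_conj_pow (r : ℝ) (n m : ℕ) :
    ∫ t in (0 : ℝ)..(2 * Real.pi), circleMap 0 r t ^ n * conj (circleMap 0 r t ^ m) =
      if n = m then ((2 * Real.pi * r ^ (2 * n) : ℝ) : ℂ) else 0 := by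
  have hfun : ∀ t : ℝ, circleMap 0 r t ^ n * conj (circleMap 0 r t ^ m) =
      (r : ℂ) ^ (n + m) * Complex.exp ((((n : ℂ) - m) * Complex.I) * t) := by
    intro t
    simp only [circleMap_zero, mul_pow, map_mul, map_pow, Complex.conj_ofReal, ← Complex.exp_conj,
      Complex.conj_I, ← Complex.exp_nat_mul, pow_add, Complex.conj_natCast]
    rw [show ((n : ℂ) - m) * Complex.I * t = n * (t * Complex.I) + m * (t * -Complex.I) by ring,
      Complex.exp_add]
    ring
  simp_rw [hfun]
  rw [intervalIntegral.integral_const_mul]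
  split_ifs with h
  · subst h
    simp [two_mul, pow_add]
    ring
  · have hc : ((n : ℂ) - m) * Complex.I ≠ 0 :=
      mul_ne_zero (sub_ne_zero.2 (by exact_mod_cast h)) Complex.I_ne_zero
    rw [integral_exp_mul_complex hc]
    have h1 : Complex.exp (((n : ℂ) - m) * Complex.I * ((2 * Real.pi : ℝ) : ℂ)) = 1 := by
      rw [Complex.exp_eq_one_iff]
      exact ⟨(n : ℤ) - m, by push_cast; ring⟩
    rw [h1]
    simp

/-- Termwise integration of a power series against a continuous function on a circle. -/
theorem hasSum_integral_circleMap {a : ℕ → ℂ} {F : ℂ → ℂ}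
    (hF : ∀ z ∈ disk, HasSum (fun n => a n * z ^ n) (F z)) {r : ℝ} (hr0 : 0 < r) (hr1 : r < 1)
    {H : ℝ → ℂ} (hH : Continuous H) :
    HasSum (fun n => a n * ∫ t in (0 : ℝ)..(2 * Real.pi), circleMap 0 r t ^ n * H t)
      (∫ t in (0 : ℝ)..(2 * Real.pi), F (circleMap 0 r t) * H t) := by
  have hmem : ∀ t : ℝ, circleMap 0 r t ∈ disk := by
    intro t
    simp [abs_of_pos hr0, hr1]
  have hsum : Summable fun n => ‖a n‖ * r ^ n := by
    have := (hF (r : ℂ) (by simp [abs_of_pos hr0, hr1])).summable.norm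
    simpa [abs_of_pos hr0] using this
  simp_rw [← intervalIntegral.integral_const_mul]
  refine intervalIntegral.hasSum_integral_of_dominated_convergence
    (fun n t => ‖a n‖ * r ^ n * ‖H t‖) ?_ ?_ ?_ ?_ ?_
  · intro n
    exact (by fun_prop : Continuous fun t => a n * (circleMap 0 r t ^ n * H t)).aestronglyMeasurable
  · intro n
    refine Eventually.of_forall fun t _ => le_of_eq ?_
    simp [abs_of_pos hr0, mul_assoc]
  · exact Eventually.of_forall fun t _ => hsum.mul_right _
  · simp_rw [tsum_mul_right]
    exact (by fun_prop : Continuous _).intervalIntegrable _ _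
  · refine Eventually.of_forall fun t _ => ?_
    simpa [mul_assoc] using (hF _ (hmem t)).mul_right (H t)

/-- **Parseval's identity** on circles, for two power series on the unit disk. -/
theorem hasSum_integral_mul_conj {a b : ℕ → ℂ} {F G : ℂ → ℂ}
    (hF : ∀ z ∈ disk, HasSum (fun n => a n * z ^ n) (F z))
    (hG : ∀ z ∈ disk, HasSum (fun n => b n * z ^ n) (G z)) {r : ℝ} (hr0 : 0 < r) (hr1 : r < 1)
    (hGc : ContinuousOn G disk) :
    HasSum (fun n => ((2 * Real.pi * r ^ (2 * n) : ℝ) : ℂ) * (a n * conj (b n)))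
      (∫ t in (0 : ℝ)..(2 * Real.pi), F (circleMap 0 r t) * conj (G (circleMap 0 r t))) := by
  have hmem : ∀ t : ℝ, circleMap 0 r t ∈ disk := by
    intro t
    simp [abs_of_pos hr0, hr1]
  have hcont : Continuous fun t => conj (G (circleMap 0 r t)) :=
    Complex.continuous_conj.comp (hGc.comp_continuous (continuous_circleMap 0 r) hmem)
  -- Termwise integration is used twice: here for F against conj G, then for G against each
  -- conjugate monomial, where orthogonality leaves one coefficient.
  refine (hasSum_integral_circleMap hF hr0 hr1 hcont).congr_fun fun n => ?_
  have h1 := hasSum_integral_circleMap hG hr0 hr1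
    (H := fun t => conj (circleMap 0 r t ^ n)) (by fun_prop)
  simp_rw [integral_circleMap_pow_mul_conj_pow] at h1
  have h2 := h1.unique (hasSum_single n (fun m hm => by simp [hm]))
  have h3 : (∫ t in (0 : ℝ)..(2 * Real.pi), circleMap 0 r t ^ n * conj (G (circleMap 0 r t))) =
      conj (∫ t in (0 : ℝ)..(2 * Real.pi), G (circleMap 0 r t) * conj (circleMap 0 r t ^ n)) := by
    rw [← intervalIntegral.intervalIntegral_conj]
    refine intervalIntegral.integral_congr fun t _ => ?_
    simp [mul_comm]
  rw [h3, h2]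
  simp only [if_true, map_mul, Complex.conj_ofReal]
  ring

/-- Taylor expansions of a holomorphic function on the disk and of its Euler derivative. -/
theorem exists_hasSum_pow {p : ℂ → ℂ} (hp : DifferentiableOn ℂ p disk) :
    ∃ a : ℕ → ℂ, ∀ z ∈ disk, HasSum (fun n => a n * z ^ n) (p z) ∧
      HasSum (fun n => (n * a n) * z ^ n) (z * deriv p z) := by
  refine ⟨fun n => (n.factorial : ℂ)⁻¹ * iteratedDeriv n p 0, fun z hz => ⟨?_, ?_⟩⟩
  · refine (Complex.hasSum_taylorSeries_on_ball hp hz).congr_fun fun n => ?_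
    simp only [sub_zero, smul_eq_mul]
    ring
  · rw [← hasSum_nat_add_iff' 1]
    have h := (Complex.hasSum_taylorSeries_on_ball (hp.deriv Metric.isOpen_ball) hz).mul_left z
    simp only [Finset.range_one, Finset.sum_singleton, Nat.cast_zero, zero_mul, sub_zero]
    refine h.congr_fun fun n => ?_
    rw [← iteratedDeriv_succ', Nat.factorial_succ]
    have h1 : (n.factorial : ℂ) ≠ 0 := by exact_mod_cast n.factorial_ne_zero
    have h2 : (n : ℂ) + 1 ≠ 0 := by exact_mod_cast n.succ_ne_zero
    simp only [sub_zero, smul_eq_mul]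
    push_cast
    field_simp
    ring

/-! ### Study's theorem -/

/-- Second order expansion of a holomorphic function. -/
theorem exists_second_order_expansion {g : ℂ → ℂ} {U : Set ℂ} (hU : IsOpen U)
    (hg : DifferentiableOn ℂ g U) {z : ℂ} (hz : z ∈ U) :
    ∃ k : ℂ → ℂ, ContinuousAt k z ∧ k z = deriv (deriv g) z / 2 ∧
      ∀ w, g w = g z + (w - z) * deriv g z + (w - z) ^ 2 * k w := by
  have h1 : DifferentiableOn ℂ (dslope g z) U :=
    (Complex.differentiableOn_dslope (hU.mem_nhds hz)).2 hg
  have h1z : DifferentiableAt ℂ (dslope g z) z := h1.differentiableAt (hU.mem_nhds hz)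
  have hg1 : ∀ w, g w = g z + (w - z) * dslope g z w := by
    intro w
    have := sub_smul_dslope g z w
    rw [smul_eq_mul] at this
    rw [this]
    ring
  refine ⟨dslope (dslope g z) z, continuousAt_dslope_same.2 h1z, ?_, fun w => ?_⟩
  · rw [dslope_same]
    -- Differentiating g = g z + (w - z) g₁ twice gives g''(z) = 2 g₁'(z), and g₁'(z) is the value
    -- at z of the second divided difference.
    have hev : deriv g =ᶠ[𝓝 z] fun w => dslope g z w + (w - z) * deriv (dslope g z) w := by
      filter_upwards [hU.mem_nhds hz] with w hw
      have hd := (h1.differentiableAt (hU.mem_nhds hw)).hasDerivAt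
      have h2 := (((hasDerivAt_id' w).sub_const z).fun_mul hd).const_add (g z)
      rw [← funext hg1] at h2
      rw [h2.deriv, one_mul]
    have hd2 := ((h1.deriv hU).differentiableAt (hU.mem_nhds hz)).hasDerivAt
    have h3 := h1z.hasDerivAt.fun_add (((hasDerivAt_id' z).sub_const z).fun_mul hd2)
    rw [hev.deriv_eq, h3.deriv]
    simp
  · have h2 := sub_smul_dslope (dslope g z) z w
    rw [smul_eq_mul, dslope_same] at h2
    rw [hg1 w]
    linear_combination -(w - z) * h2

/-- **Study's theorem**: an injective holomorphic function on the disk whose image is (midpoint)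
convex satisfies `Re (1 + z g'' / g') ≥ 0`. -/
theorem re_one_add_nonneg_of_midpoint_convex {g : ℂ → ℂ} (hg : DifferentiableOn ℂ g disk)
    (hinj : InjOn g disk)
    (hconv : ∀ a ∈ disk, ∀ b ∈ disk, ∃ c ∈ disk, g c = (g a + g b) / 2) {z : ℂ} (hz : z ∈ disk) :
    0 ≤ (1 + z * deriv (deriv g) z / deriv g z).re := by
  rcases eq_or_ne z 0 with rfl | hz0
  · simp
  have hU : IsOpen disk := Metric.isOpen_ball
  have hd := deriv_ne_zero_of_injOn hU hg hinj hz
  obtain ⟨k, hkc, hkz, hk⟩ := exists_second_order_expansion hU hg hz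
  set G := Function.invFunOn g disk with hG
  have hGd : ∀ w ∈ disk, HasDerivAt G (deriv g w)⁻¹ (g w) := fun w hw =>
    hasDerivAt_invFunOn hU hg hinj hw
  have hGg : ∀ w ∈ disk, G (g w) = w := fun w hw => hinj.leftInvOn_invFunOn hw
  -- A rational parametrization of the unit circle near 1, with e (-τ) the conjugate of e τ. By
  -- convexity, the inverse of g applied to the average of g (e τ w) and g (e (-τ) w) is a self-map
  -- of the disk fixing 0. Schwarz's lemma bounds it by |z| at z, and the τ² term of this bound is
  -- Study's inequality.
  set e : ℝ → ℂ := fun τ => (1 + τ * Complex.I) / (1 - τ * Complex.I) with he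
  have hden : ∀ τ : ℝ, (1 : ℂ) - τ * Complex.I ≠ 0 := by
    intro τ h
    simpa using congrArg Complex.re h
  have hden' : ∀ τ : ℝ, (1 : ℂ) + τ * Complex.I ≠ 0 := by
    intro τ h
    simpa using congrArg Complex.re h
  have hen : ∀ τ, ‖e τ‖ = 1 := by
    intro τ
    have h1 : (1 : ℂ) - τ * Complex.I = conj (1 + τ * Complex.I) := by simp [sub_eq_add_neg]
    rw [he]
    simp only [norm_div]
    rw [h1, RCLike.norm_conj, div_self (norm_ne_zero_iff.2 (hden' τ))]
  have hem : ∀ τ, ∀ w ∈ disk, e τ * w ∈ disk := by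
    intro τ w hw
    simpa [hen] using hw
  set h : ℝ → ℂ → ℂ := fun τ w => (g (e τ * w) + g (e (-τ) * w)) / 2 with hh
  have hschwarz : ∀ τ, ‖G (h τ z)‖ ≤ ‖z‖ := by
    intro τ
    refine Complex.norm_le_norm_of_mapsTo_ball (f := fun w => G (h τ w)) (R := 1)
      (fun w hw => ?_) (fun w hw => ?_) ?_ (by simpa using hz)
    · obtain ⟨c, hc, hgc⟩ := hconv _ (hem τ w hw) _ (hem (-τ) w hw)
      have h1 : DifferentiableAt ℂ G (h τ w) := by
        rw [hh]
        simp only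
        rw [← hgc]
        exact (hGd c hc).differentiableAt
      have h2 : ∀ σ, DifferentiableAt ℂ (fun w => g (e σ * w)) w := fun σ =>
        DifferentiableAt.comp (g := g) w (hg.differentiableAt (hU.mem_nhds (hem σ w hw)))
          (by fun_prop)
      exact (DifferentiableAt.comp (g := G) w h1
        (((h2 τ).add (h2 (-τ))).div_const 2)).differentiableWithinAt
    · obtain ⟨c, hc, hgc⟩ := hconv _ (hem τ w hw) _ (hem (-τ) w hw)
      simp only [hh]
      rw [← hgc, hGg c hc]
      exact Metric.ball_subset_closedBall hc
    · have h0 : (0 : ℂ) ∈ disk := by simp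
      simp only [hh, mul_zero, add_self_div_two]
      exact hGg 0 h0
  have hec : Continuous e := by
    have h1 : Continuous fun τ : ℝ => (1 : ℂ) + τ * Complex.I := by fun_prop
    have h2 : Continuous fun τ : ℝ => (1 : ℂ) - τ * Complex.I := by fun_prop
    exact h1.div h2 hden
  have he0 : e 0 = 1 := by simp [he]
  have hk1 : Tendsto (fun τ => k (e τ * z)) (𝓝 0) (𝓝 (k z)) := by
    have : Tendsto (fun τ => e τ * z) (𝓝 0) (𝓝 z) := by
      simpa [he0] using (hec.mul_const z).tendsto 0
    exact hkc.tendsto.comp this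
  have hk2 : Tendsto (fun τ => k (e (-τ) * z)) (𝓝 0) (𝓝 (k z)) := by
    have : Tendsto (fun τ : ℝ => -τ) (𝓝 0) (𝓝 0) := by
      simpa using (continuous_neg (G := ℝ)).tendsto 0
    exact hk1.comp this
  set A : ℝ → ℂ := fun τ => -2 / ((1 - τ * Complex.I) * (1 + τ * Complex.I)) * z * deriv g z +
    (-2 / (1 - τ * Complex.I) ^ 2 * z ^ 2 * k (e τ * z) +
      -2 / (1 + τ * Complex.I) ^ 2 * z ^ 2 * k (e (-τ) * z)) with hA
  have hAh : ∀ τ : ℝ, h τ z - g z = τ ^ 2 * A τ := by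
    intro τ
    have h1 : e τ * z - z = 2 * τ * Complex.I / (1 - τ * Complex.I) * z := by
      rw [he]
      field_simp [hden τ]
      ring
    have h2 : e (-τ) * z - z = -2 * τ * Complex.I / (1 + τ * Complex.I) * z := by
      have := hden' τ
      rw [he]
      simp only [Complex.ofReal_neg, neg_mul, sub_neg_eq_add]
      field_simp
      ring
    have h3 := hk (e τ * z)
    have h4 := hk (e (-τ) * z)
    rw [h1] at h3
    rw [h2] at h4
    simp only [hh]
    rw [h3, h4, hA]
    have := hden' τ
    have := hden τ
    simp only
    field_simp
    ring_nf
    simp only [Complex.I_sq, show Complex.I ^ 4 = 1 from Complex.I_pow_four,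
      show Complex.I ^ 3 = -Complex.I from Complex.I_pow_three]
    ring
  have hAlim : Tendsto A (𝓝 0) (𝓝 (-2 * z * (deriv g z + z * deriv (deriv g) z))) := by
    have c1 : Continuous fun τ : ℝ => (1 : ℂ) + τ * Complex.I := by fun_prop
    have c2 : Continuous fun τ : ℝ => (1 : ℂ) - τ * Complex.I := by fun_prop
    have t1 : Tendsto (fun τ : ℝ => -2 / (((1 : ℂ) - τ * Complex.I) * (1 + τ * Complex.I)))
        (𝓝 0) (𝓝 (-2)) := by
      have c : Continuous fun τ : ℝ => -2 / (((1 : ℂ) - τ * Complex.I) * (1 + τ * Complex.I)) :=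
        (continuous_const (y := (-2 : ℂ))).div (c2.mul c1)
          (fun τ => mul_ne_zero (hden τ) (hden' τ))
      simpa using c.tendsto 0
    have t2 : Tendsto (fun τ : ℝ => -2 / ((1 : ℂ) - τ * Complex.I) ^ 2) (𝓝 0) (𝓝 (-2)) := by
      have c : Continuous fun τ : ℝ => -2 / ((1 : ℂ) - τ * Complex.I) ^ 2 :=
        (continuous_const (y := (-2 : ℂ))).div (c2.pow 2) (fun τ => pow_ne_zero 2 (hden τ))
      simpa using c.tendsto 0
    have t3 : Tendsto (fun τ : ℝ => -2 / ((1 : ℂ) + τ * Complex.I) ^ 2) (𝓝 0) (𝓝 (-2)) := by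
      have c : Continuous fun τ : ℝ => -2 / ((1 : ℂ) + τ * Complex.I) ^ 2 :=
        (continuous_const (y := (-2 : ℂ))).div (c1.pow 2) (fun τ => pow_ne_zero 2 (hden' τ))
      simpa using c.tendsto 0
    have := ((t1.mul_const z).mul_const (deriv g z)).add
      (((t2.mul_const (z ^ 2)).mul hk1).add ((t3.mul_const (z ^ 2)).mul hk2))
    convert this using 2
    rw [hkz]
    ring
  have hhlim : Tendsto (fun τ => h τ z) (𝓝 0) (𝓝 (g z)) := by
    have h1 : Tendsto (fun τ : ℝ => g z + (τ : ℂ) ^ 2 * A τ) (𝓝 0) (𝓝 (g z)) := by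
      have h2 : Tendsto (fun τ : ℝ => (τ : ℂ) ^ 2) (𝓝 0) (𝓝 0) := by
        have c : Continuous fun τ : ℝ => (τ : ℂ) ^ 2 := by fun_prop
        simpa using c.tendsto 0
      simpa using (h2.mul hAlim).const_add (g z)
    refine h1.congr fun τ => ?_
    rw [← hAh τ]
    ring
  set D : ℝ → ℂ := fun τ => dslope G (g z) (h τ z) * A τ with hD
  have hDlim : Tendsto D (𝓝 0)
      (𝓝 ((deriv g z)⁻¹ * (-2 * z * (deriv g z + z * deriv (deriv g) z)))) := by
    have h1 : ContinuousAt (dslope G (g z)) (g z) :=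
      continuousAt_dslope_same.2 (hGd z hz).differentiableAt
    have h2 := h1.tendsto.comp hhlim
    rw [dslope_same, (hGd z hz).deriv] at h2
    exact h2.mul hAlim
  have hDG : ∀ τ : ℝ, G (h τ z) = z + τ ^ 2 * D τ := by
    intro τ
    have h1 := sub_smul_dslope G (g z) (h τ z)
    rw [smul_eq_mul, hAh, hGg z hz] at h1
    rw [hD]
    linear_combination -h1
  have hineq : ∀ᶠ τ : ℝ in 𝓝[≠] 0, 2 * (conj z * D τ).re + τ ^ 2 * ‖D τ‖ ^ 2 ≤ 0 := by
    filter_upwards [self_mem_nhdsWithin] with τ hτ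
    have h1 : ‖z + (τ : ℂ) ^ 2 * D τ‖ ^ 2 ≤ ‖z‖ ^ 2 := by
      rw [← hDG]
      exact pow_le_pow_left₀ (norm_nonneg _) (hschwarz τ) 2
    have h2 : ‖z + (τ : ℂ) ^ 2 * D τ‖ ^ 2 =
        ‖z‖ ^ 2 + τ ^ 2 * (2 * (conj z * D τ).re + τ ^ 2 * ‖D τ‖ ^ 2) := by
      simp only [← Complex.normSq_eq_norm_sq, Complex.normSq_apply, ← Complex.ofReal_pow,
        Complex.add_re, Complex.add_im, Complex.mul_re, Complex.mul_im,
        Complex.ofReal_re, Complex.ofReal_im, Complex.conj_re, Complex.conj_im]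
      ring
    have hτ2 : 0 < τ ^ 2 := by
      have : τ ≠ 0 := hτ
      positivity
    rw [h2] at h1
    by_contra hcon
    push Not at hcon
    have := mul_pos hτ2 hcon
    linarith
  have hlim : Tendsto (fun τ : ℝ => 2 * (conj z * D τ).re + τ ^ 2 * ‖D τ‖ ^ 2) (𝓝[≠] 0)
      (𝓝 (2 * (conj z *
        ((deriv g z)⁻¹ * (-2 * z * (deriv g z + z * deriv (deriv g) z)))).re)) := by
    refine Tendsto.mono_left ?_ nhdsWithin_le_nhds
    have h1 := ((Complex.continuous_re.tendsto _).comp (hDlim.const_mul (conj z))).const_mul 2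
    have h2 : Tendsto (fun τ : ℝ => τ ^ 2) (𝓝 0) (𝓝 0) := by
      simpa using (continuous_pow 2).tendsto (0 : ℝ)
    simpa using h1.add (h2.mul (hDlim.norm.pow 2))
  have hfin := le_of_tendsto hlim hineq
  -- The limiting expression is -2 |z|² times 1 + z g'' / g', so nonpositivity of its real part is
  -- the claim.
  have hrew : conj z * ((deriv g z)⁻¹ * (-2 * z * (deriv g z + z * deriv (deriv g) z))) =
      ((-2 * ‖z‖ ^ 2 : ℝ) : ℂ) * (1 + z * deriv (deriv g) z / deriv g z) := by
    have : (‖z‖ ^ 2 : ℂ) = conj z * z := (Complex.conj_mul' z).symm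
    push_cast
    rw [this]
    field_simp
  rw [hrew, Complex.re_ofReal_mul] at hfin
  have hzp : 0 < ‖z‖ ^ 2 := by positivity
  by_contra hcon
  push Not at hcon
  nlinarith [mul_pos hzp (neg_pos.2 hcon)]

/-! ### Convex lifts and the curvature inequality -/

/-- A holomorphic lift `(p, q)` to `ℂ²` of an injective meromorphic map `q / p` of the disk onto a
spherically convex proper subset of the sphere, normalized to have Wronskian one. Geodesic
convexity is expressed through the Hopf coordinates `(y x̄, |y|² - |x|²)` of the direction of
`(x, y) ∈ ℂ²`. -/
structure ConvexLift (p q : ℂ → ℂ) : Prop where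
  diff_fst : DifferentiableOn ℂ p disk
  diff_snd : DifferentiableOn ℂ q disk
  wronskian : ∀ z ∈ disk, p z * deriv q z - deriv p z * q z = 1
  inj : ∀ a ∈ disk, ∀ b ∈ disk, p a * q b = p b * q a → a = b
  arc : ∀ a ∈ disk, ∀ b ∈ disk, p a * conj (p b) + q a * conj (q b) ≠ 0 →
    ∀ (x y : ℂ) (s t : ℝ), 0 ≤ s → 0 ≤ t → (x ≠ 0 ∨ y ≠ 0) →
      y * conj x = s * (q a * conj (p a)) + t * (q b * conj (p b)) →
      y * conj y - x * conj x = s * (q a * conj (q a) - p a * conj (p a)) +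
        t * (q b * conj (q b) - p b * conj (p b)) →
      ∃ c ∈ disk, p c * y = q c * x
  not_surj : ∃ x y : ℂ, ∀ z ∈ disk, p z * y ≠ q z * x

namespace ConvexLift

variable {p q : ℂ → ℂ}

theorem differentiableAt_fst (h : ConvexLift p q) {z : ℂ} (hz : z ∈ disk) :
    DifferentiableAt ℂ p z :=
  h.diff_fst.differentiableAt (Metric.isOpen_ball.mem_nhds hz)

theorem differentiableAt_snd (h : ConvexLift p q) {z : ℂ} (hz : z ∈ disk) :
    DifferentiableAt ℂ q z :=
  h.diff_snd.differentiableAt (Metric.isOpen_ball.mem_nhds hz)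

theorem norm_sq_pos (h : ConvexLift p q) {z : ℂ} (hz : z ∈ disk) :
    0 < ‖p z‖ ^ 2 + ‖q z‖ ^ 2 := by
  have hw := h.wronskian z hz
  rcases eq_or_ne (p z) 0 with hp | hp
  · have hq : q z ≠ 0 := by
      intro hq
      simp [hp, hq] at hw
    positivity
  · positivity

/-- Rotations of the sphere act on lifts through `SU(2)`. -/
theorem rotate (h : ConvexLift p q) {α β : ℂ} (hN : α * conj α + β * conj β = 1) :
    ConvexLift (fun z => α * p z + β * q z) (fun z => -conj β * p z + conj α * q z) where
  diff_fst := (h.diff_fst.const_mul α).add (h.diff_snd.const_mul β)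
  diff_snd := (h.diff_fst.const_mul _).add (h.diff_snd.const_mul _)
  wronskian z hz := by
    have hp := (h.differentiableAt_fst hz).hasDerivAt
    have hq := (h.differentiableAt_snd hz).hasDerivAt
    rw [((hp.const_mul α).fun_add (hq.const_mul β)).deriv,
      ((hp.const_mul (-conj β)).fun_add (hq.const_mul (conj α))).deriv]
    linear_combination h.wronskian z hz + (p z * deriv q z - deriv p z * q z) * hN
  inj a ha b hb hab := by
    refine h.inj a ha b hb ?_
    linear_combination hab - (p a * q b - p b * q a) * hN
  arc a ha b hb hne x y s t hs ht hxy h1 h2 := by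
    have hN' : conj α * α + conj β * β = 1 := by
      linear_combination hN
    simp only [map_add, map_mul, map_neg, Complex.conj_conj] at hne h1 h2
    have h1c := congrArg conj h1
    simp only [map_add, map_mul, map_neg, Complex.conj_conj, Complex.conj_ofReal] at h1c
    obtain ⟨c, hc, hcxy⟩ := h.arc a ha b hb (fun h0 => hne (by
        linear_combination h0 + (p a * conj (p b) + q a * conj (q b)) * hN))
      -- The inverse SU(2) matrix applied to (x, y). The combinations of `h1`, `h1c` and `h2` below
      -- are the inverse rotation acting on Hopf coordinates.
      (conj α * x - β * y) (conj β * x + α * y) s t hs ht (by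
        by_contra! hcon
        obtain ⟨hx, hy⟩ := hcon
        have hx0 : x = 0 := by
          linear_combination α * hx + β * hy - x * hN
        have hy0 : y = 0 := by
          linear_combination -conj β * hx + conj α * hy - y * hN
        simp [hx0, hy0] at hxy) (by
        simp only [map_sub, map_mul, Complex.conj_conj]
        linear_combination α ^ 2 * h1 - conj β ^ 2 * h1c - α * conj β * h2 +
          (α * conj α + β * conj β + 1) *
            (s * (q a * conj (p a)) + t * (q b * conj (p b))) * hN) (by
        simp only [map_sub, map_add, map_mul, Complex.conj_conj]
        linear_combination 2 * α * β * h1 + 2 * conj α * conj β * h1c +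
          (α * conj α - β * conj β) * h2 +
          (α * conj α + β * conj β + 1) * (s * (q a * conj (q a) - p a * conj (p a)) +
        t * (q b * conj (q b) - p b * conj (p b))) * hN)
    refine ⟨c, hc, ?_⟩
    linear_combination hcxy
  not_surj := by
    obtain ⟨x, y, hxy⟩ := h.not_surj
    refine ⟨α * x + β * y, -conj β * x + conj α * y, fun z hz heq => hxy z hz ?_⟩
    linear_combination heq - (p z * y - q z * x) * hN

/-- A point of the disk can be rotated to the origin of the sphere. -/
theorem exists_rotation (h : ConvexLift p q) {z : ℂ} (hz : z ∈ disk) :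
    ∃ (r : ℝ) (α β : ℂ), r ≠ 0 ∧ α * conj α + β * conj β = 1 ∧
      α = r * conj (p z) ∧ β = r * conj (q z) ∧ -conj β * p z + conj α * q z = 0 := by
  have hpos := h.norm_sq_pos hz
  set r : ℝ := (Real.sqrt (‖p z‖ ^ 2 + ‖q z‖ ^ 2))⁻¹ with hr
  have hrpos : 0 < r := inv_pos.2 (Real.sqrt_pos.2 hpos)
  have hr2 : r ^ 2 * (‖p z‖ ^ 2 + ‖q z‖ ^ 2) = 1 := by
    rw [hr, inv_pow, Real.sq_sqrt hpos.le, inv_mul_cancel₀ hpos.ne']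
  refine ⟨r, _, _, hrpos.ne', ?_, rfl, rfl, ?_⟩
  · simp only [map_mul, Complex.conj_conj, Complex.conj_ofReal]
    have h1 : ((r ^ 2 * (‖p z‖ ^ 2 + ‖q z‖ ^ 2) : ℝ) : ℂ) = 1 := by rw [hr2]; simp
    push_cast at h1
    rw [← Complex.conj_mul', ← Complex.conj_mul'] at h1
    linear_combination h1
  · simp only [map_mul, Complex.conj_conj, Complex.conj_ofReal]
    ring

/-- A convex proper subset of the sphere that contains `0` does not contain `∞`. -/
theorem fst_ne_zero (h : ConvexLift p q) {z₀ : ℂ} (hz₀ : z₀ ∈ disk) (hq : q z₀ = 0) {z : ℂ}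
    (hz : z ∈ disk) : p z ≠ 0 := by
  intro hp
  have hw := h.wronskian z hz
  have hw0 := h.wronskian z₀ hz₀
  have hp0 : p z₀ ≠ 0 := by
    intro h0
    simp [h0, hq] at hw0
  have hqz : q z ≠ 0 := by
    intro h0
    simp [h0, hp] at hw
  obtain ⟨x, y, hxy⟩ := h.not_surj
  have hx : x ≠ 0 := by
    rintro rfl
    exact hxy z hz (by simp [hp])
  have hy : y ≠ 0 := by
    rintro rfl
    exact hxy z₀ hz₀ (by simp [hq])
  -- Near its pole z the map is open, so for some τ in (0, 1) it takes the value (y / x) / τ,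
  -- farther out on the ray from 0 through the omitted value y / x. The arc from there to 0 passes
  -- through y / x.
  set k : ℂ → ℂ := fun w => p w / q w with hk
  have hka : AnalyticAt ℂ k z :=
    (h.diff_fst.analyticAt (Metric.isOpen_ball.mem_nhds hz)).div
      (h.diff_snd.analyticAt (Metric.isOpen_ball.mem_nhds hz)) hqz
  have hkd : deriv k z ≠ 0 := by
    have := (h.differentiableAt_fst hz).hasDerivAt.fun_div
      (h.differentiableAt_snd hz).hasDerivAt hqz
    rw [this.deriv]
    refine div_ne_zero ?_ (pow_ne_zero 2 hqz)
    intro h0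
    have : (1 : ℂ) = 0 := by linear_combination -hw - h0
    exact one_ne_zero this
  have hmap := hka.hasStrictDerivAt.map_nhds_eq hkd
  have hkz : k z = 0 := by simp [hk, hp]
  have himg : k '' {w | w ∈ disk ∧ q w ≠ 0} ∈ 𝓝 (0 : ℂ) := by
    rw [hkz] at hmap
    rw [← hmap]
    exact image_mem_map ((Metric.isOpen_ball.eventually_mem hz).and
      ((h.differentiableAt_snd hz).continuousAt.eventually_ne hqz))
  have hlim : Tendsto (fun τ : ℝ => (τ : ℂ) * (x / y)) (𝓝 0) (𝓝 0) := by
    have c : Continuous fun τ : ℝ => (τ : ℂ) * (x / y) := by fun_prop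
    simpa using c.tendsto 0
  have hev : ∀ᶠ τ : ℝ in 𝓝[>] 0, (τ : ℂ) * (x / y) ∈ k '' {w | w ∈ disk ∧ q w ≠ 0} :=
    (hlim.eventually himg).filter_mono nhdsWithin_le_nhds
  obtain ⟨τ, ⟨w, ⟨hw1, hqw⟩, hkw⟩, hτ0, hτ1⟩ :=
    (hev.and (Ioo_mem_nhdsGT (zero_lt_one' ℝ))).exists
  have hpw : p w * y = τ * (q w * x) := by
    simp only [hk] at hkw
    field_simp at hkw
    linear_combination hkw
  have hpw0 : p w ≠ 0 := by
    intro h0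
    rw [h0, zero_mul, eq_comm] at hpw
    simp [hτ0.ne', hqw, hx] at hpw
  -- the direction of `(x, y)` lies on the arc joining those of `w` and `z₀`
  set s : ℝ := τ * ‖x‖ ^ 2 / ‖p w‖ ^ 2 with hs
  set t : ℝ := ((1 - τ) * ‖x‖ ^ 2 + (1 / τ - 1) * ‖y‖ ^ 2) / ‖p z₀‖ ^ 2 with ht
  have hsC : (s : ℂ) * (p w * conj (p w)) = τ * (x * conj x) := by
    have h1 : s * ‖p w‖ ^ 2 = τ * ‖x‖ ^ 2 := by
      rw [hs]
      field_simp
    rw [Complex.mul_conj', Complex.mul_conj']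
    exact_mod_cast h1
  have htC : (t : ℂ) * (p z₀ * conj (p z₀)) =
      (1 - τ) * (x * conj x) + (1 / τ - 1) * (y * conj y) := by
    have h1 : t * ‖p z₀‖ ^ 2 = (1 - τ) * ‖x‖ ^ 2 + (1 / τ - 1) * ‖y‖ ^ 2 := by
      rw [ht]
      field_simp
    rw [Complex.mul_conj', Complex.mul_conj', Complex.mul_conj']
    exact_mod_cast h1
  have hτC : (τ : ℂ) ≠ 0 := by exact_mod_cast hτ0.ne'
  have hcp : conj (p w) ≠ 0 := by simpa using hpw0
  have hpwc := congrArg conj hpw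
  simp only [map_mul, Complex.conj_ofReal] at hpwc
  have hsq : (s : ℂ) * (q w * conj (q w)) = 1 / τ * (y * conj y) := by
    refine mul_left_cancel₀ (mul_ne_zero hτC (mul_ne_zero hpw0 hcp)) ?_
    have h1 : (τ : ℂ) * (1 / τ) = 1 := by field_simp
    linear_combination τ * (q w * conj (q w)) * hsC - conj (p w) * conj y * hpw -
      τ * q w * x * hpwc - (p w * conj (p w)) * (y * conj y) * h1
  obtain ⟨c, hc, hcxy⟩ := h.arc w hw1 z₀ hz₀
    (by simpa [hq] using ⟨hpw0, hp0⟩) x y s t (by positivity)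
    (by
      have h1 : 0 ≤ 1 - τ := by linarith
      have h2 : 0 ≤ 1 / τ - 1 := sub_nonneg.2 (by rw [le_div_iff₀ hτ0]; linarith)
      positivity)
    (Or.inl hx) (by
      rw [hq]
      refine mul_left_cancel₀ hpw0 ?_
      linear_combination conj x * hpw - q w * hsC) (by
      rw [hq]
      linear_combination -hsq + hsC + htC)
  exact hxy c hc hcxy

/-- A convex proper subset of the sphere contains no pair of antipodal points. -/
theorem inner_ne_zero (h : ConvexLift p q) {a b : ℂ} (ha : a ∈ disk) (hb : b ∈ disk) :
    p a * conj (p b) + q a * conj (q b) ≠ 0 := by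
  obtain ⟨r, α, β, hr, hN, hα, hβ, h0⟩ := h.exists_rotation hb
  have h1 := (h.rotate hN).fst_ne_zero hb h0 ha
  intro h2
  refine h1 ?_
  simp only [hα, hβ]
  linear_combination r * h2

/-- Any direction of `ℝ³ = ℂ × ℝ` is a direction in Hopf coordinates. -/
theorem _root_.SphGeom.exists_hopf (w : ℂ) (k : ℝ) :
    ∃ x y : ℂ, y * conj x = w ∧ y * conj y - x * conj x = k := by
  -- This is the value |x|² + |y|² must have, whence |x|² = (n - k) / 2. The case n = k is x = 0.
  set n : ℝ := Real.sqrt (4 * ‖w‖ ^ 2 + k ^ 2) with hn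
  have hnk : |k| ≤ n := by
    rw [← Real.sqrt_sq_eq_abs]
    exact Real.sqrt_le_sqrt (by nlinarith [norm_nonneg w])
  have hn2 : n ^ 2 = 4 * ‖w‖ ^ 2 + k ^ 2 := Real.sq_sqrt (by positivity)
  rcases eq_or_lt_of_le ((le_abs_self k).trans hnk) with heq | hlt
  · have hw : w = 0 := by
      have : ‖w‖ ^ 2 = 0 := by rw [← heq] at hn2; linarith
      simpa using this
    have hk : 0 ≤ k := by rw [heq]; exact Real.sqrt_nonneg _
    refine ⟨0, Real.sqrt k, by simp [hw], ?_⟩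
    simp only [Complex.conj_ofReal, zero_mul, sub_zero]
    exact_mod_cast Real.mul_self_sqrt hk
  · set x : ℝ := Real.sqrt ((n - k) / 2) with hx
    have hx2 : x ^ 2 = (n - k) / 2 := Real.sq_sqrt (by linarith)
    have hx0 : x ≠ 0 := (Real.sqrt_pos.2 (by linarith)).ne'
    have hxC : (x : ℂ) ≠ 0 := by exact_mod_cast hx0
    refine ⟨x, w / x, ?_, ?_⟩
    · rw [Complex.conj_ofReal, div_mul_cancel₀ _ hxC]
    · rw [Complex.mul_conj', Complex.mul_conj', norm_div, Complex.norm_real, Real.norm_eq_abs]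
      have h1 : (‖w‖ / |x|) ^ 2 - |x| ^ 2 = k := by
        rw [div_pow, sq_abs, hx2]
        have : n - k ≠ 0 := by linarith
        field_simp
        nlinarith
      exact_mod_cast h1

/-- A spherically convex domain containing `0` is convex in the plane. -/
theorem exists_midpoint (h : ConvexLift p q) {z₀ : ℂ} (hz₀ : z₀ ∈ disk) (hq : q z₀ = 0)
    {a b : ℂ} (ha : a ∈ disk) (hb : b ∈ disk) :
    ∃ c ∈ disk, q c / p c = (q a / p a + q b / p b) / 2 := by
  have hp : ∀ z ∈ disk, p z ≠ 0 := fun z hz => h.fst_ne_zero hz₀ hq hz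
  have hpa := hp a ha
  have hpb := hp b hb
  have hp0 := hp z₀ hz₀
  set A := q a / p a with hA
  set B := q b / p b with hB
  have hqa : q a = A * p a := by rw [hA]; field_simp
  have hqb : q b = B * p b := by rw [hB]; field_simp
  have hinner := h.inner_ne_zero ha hb
  have hAB : 1 + A * conj B ≠ 0 := by
    intro h0
    refine hinner ?_
    rw [hqa, hqb, map_mul]
    linear_combination p a * conj (p b) * h0
  -- The average of the Hopf vectors (A, |A|² - 1) and (B, |B|² - 1), a direction on the arc from A
  -- to B. It vanishes only if A and B are antipodal.
  obtain ⟨x, y, hxy1, hxy2⟩ := exists_hopf ((A + B) / 2) ((‖A‖ ^ 2 + ‖B‖ ^ 2) / 2 - 1)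
  push_cast at hxy2
  rw [← Complex.mul_conj', ← Complex.mul_conj'] at hxy2
  have hpna : (p a * conj (p a)) ≠ 0 := by simpa using hpa
  have hpnb : (p b * conj (p b)) ≠ 0 := by simpa using hpb
  have hpn0 : (p z₀ * conj (p z₀)) ≠ 0 := by simpa using hp0
  have hxyne : x ≠ 0 ∨ y ≠ 0 := by
    by_contra! hcon
    obtain ⟨rfl, rfl⟩ := hcon
    simp only [map_zero, mul_zero, sub_self] at hxy1 hxy2
    have hBA : B = -A := by linear_combination -2 * hxy1
    rw [hBA] at hxy2 hAB
    simp only [map_neg] at hxy2 hAB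
    exact hAB (by linear_combination hxy2)
  obtain ⟨c, hc, hcxy⟩ := h.arc a ha b hb hinner x y (1 / (2 * ‖p a‖ ^ 2)) (1 / (2 * ‖p b‖ ^ 2))
    (by positivity) (by positivity) hxyne (by
      push_cast
      rw [← Complex.mul_conj', ← Complex.mul_conj', hxy1, hqa, hqb]
      have : conj (p a) ≠ 0 := by simpa using hpa
      have : conj (p b) ≠ 0 := by simpa using hpb
      field_simp) (by
      push_cast
      rw [← Complex.mul_conj', ← Complex.mul_conj', hxy2, hqa, hqb, map_mul, map_mul]
      have : conj (p a) ≠ 0 := by simpa using hpa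
      have : conj (p b) ≠ 0 := by simpa using hpb
      field_simp
      ring)
  have hpc := hp c hc
  set C := q c / p c with hC
  have hqc : q c = C * p c := by rw [hC]; field_simp
  have hyx : y = C * x := by
    refine mul_left_cancel₀ hpc ?_
    rw [hcxy, hqc]
    ring
  have hpnc : (p c * conj (p c)) ≠ 0 := by simpa using hpc
  -- Moving from that direction towards 0, whose Hopf vector points along (0, -1), subtracts |A -
  -- B|² / 4 from the last coordinate. By the parallelogram law this reaches the Hopf vector of (1,
  -- (A + B) / 2).
  obtain ⟨d, hd, hdm⟩ := h.arc c hc z₀ hz₀ (by simpa [hq] using ⟨hpc, hp0⟩) 1 ((A + B) / 2)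
    (‖x‖ ^ 2 / ‖p c‖ ^ 2) (‖A - B‖ ^ 2 / (4 * ‖p z₀‖ ^ 2)) (by positivity) (by positivity)
    (Or.inl one_ne_zero) (by
      push_cast
      rw [← Complex.mul_conj', ← Complex.mul_conj', hq, hqc, ← hxy1, hyx]
      have : conj (p c) ≠ 0 := by simpa using hpc
      simp only [map_one]
      field_simp
      ring) (by
      push_cast
      rw [← Complex.mul_conj', ← Complex.mul_conj', ← Complex.mul_conj', ← Complex.mul_conj', hq,
        hqc]
      rw [hyx] at hxy2
      have h1 : conj (p c) ≠ 0 := by simpa using hpc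
      have h2 : conj (p z₀) ≠ 0 := by simpa using hp0
      simp only [map_mul] at hxy2
      have e1 : x * conj x / (p c * conj (p c)) *
          (C * p c * conj (C * p c) - p c * conj (p c)) =
          C * x * (conj C * conj x) - x * conj x := by
        rw [map_mul]
        field_simp
      have e2 : (A - B) * conj (A - B) / (4 * (p z₀ * conj (p z₀))) *
          (0 * conj 0 - p z₀ * conj (p z₀)) = -((A - B) * conj (A - B)) / 4 := by
        field_simp
        ring
      rw [e1, e2, hxy2]
      simp only [map_one, map_div₀, map_add, map_sub, Complex.conj_ofNat]
      ring)
  refine ⟨d, hd, ?_⟩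
  rw [div_eq_iff (hp d hd)]
  linear_combination -hdm

/-- The curvature inequality at a point which is mapped to the origin of the sphere. -/
theorem two_mul_re_le_of_snd_eq_zero (h : ConvexLift p q) {z : ℂ} (hz : z ∈ disk)
    (hq : q z = 0) : 2 * (z * deriv p z * conj (p z)).re ≤ ‖p z‖ ^ 2 := by
  have hp : ∀ w ∈ disk, p w ≠ 0 := fun w hw => h.fst_ne_zero hz hq hw
  have hU : IsOpen disk := Metric.isOpen_ball
  have hder : ∀ w ∈ disk, HasDerivAt (fun w => q w / p w) (1 / p w ^ 2) w := by
    intro w hw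
    have h1 := (h.differentiableAt_snd hw).hasDerivAt.fun_div
      (h.differentiableAt_fst hw).hasDerivAt (hp w hw)
    rwa [show deriv q w * p w - q w * deriv p w = 1 by
      linear_combination h.wronskian w hw] at h1
  -- Since (q / p)' = p⁻², Study's expression is 1 - 2 z p' / p; multiplied by |p|² it gives the
  -- claim.
  have hS := re_one_add_nonneg_of_midpoint_convex (g := fun w => q w / p w)
    (fun w hw => (hder w hw).differentiableAt.differentiableWithinAt)
    (fun a ha b hb hab => h.inj a ha b hb (by
      have h1 := hp a ha
      have h2 := hp b hb
      simp only at hab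
      field_simp at hab
      linear_combination -hab))
    (fun a ha b hb => h.exists_midpoint hz hq ha hb) hz
  have hder2 : deriv (deriv fun w => q w / p w) z = -2 * deriv p z / p z ^ 3 := by
    have hev : (deriv fun w => q w / p w) =ᶠ[𝓝 z] fun w => 1 / p w ^ 2 := by
      filter_upwards [hU.mem_nhds hz] with w hw using (hder w hw).deriv
    have hpz := hp z hz
    have h1 := (hasDerivAt_const z (1 : ℂ)).fun_div
      ((h.differentiableAt_fst hz).hasDerivAt.fun_pow 2) (pow_ne_zero 2 hpz)
    rw [hev.deriv_eq, h1.deriv]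
    field_simp
    ring
  rw [hder2, (hder z hz).deriv] at hS
  have hpz := hp z hz
  have hrw : 1 + z * (-2 * deriv p z / p z ^ 3) / (1 / p z ^ 2) =
      ((1 / ‖p z‖ ^ 2 : ℝ) : ℂ) * ((‖p z‖ ^ 2 : ℝ) - 2 * (z * deriv p z * conj (p z))) := by
    push_cast
    rw [← Complex.mul_conj']
    have : conj (p z) ≠ 0 := by simpa using hpz
    field_simp
    ring
  rw [hrw, Complex.re_ofReal_mul, Complex.sub_re, Complex.ofReal_re] at hS
  have h2 : (2 * (z * deriv p z * conj (p z))).re = 2 * (z * deriv p z * conj (p z)).re := by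
    simp
  rw [h2] at hS
  have h3 := nonneg_of_mul_nonneg_right hS (by positivity)
  linarith

/-- The image circles of a spherically convex function have nonnegative geodesic curvature. -/
theorem two_mul_re_le (h : ConvexLift p q) {z : ℂ} (hz : z ∈ disk) :
    2 * (z * deriv p z * conj (p z) + z * deriv q z * conj (q z)).re ≤
      ‖p z‖ ^ 2 + ‖q z‖ ^ 2 := by
  obtain ⟨r, α, β, -, hN, -, -, h0⟩ := h.exists_rotation hz
  have h1 := (h.rotate hN).two_mul_re_le_of_snd_eq_zero hz h0
  have h0c := congrArg conj h0
  simp only [map_add, map_mul, map_neg, Complex.conj_conj, map_zero] at h0c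
  have hder : deriv (fun z => α * p z + β * q z) z = α * deriv p z + β * deriv q z :=
    (((h.differentiableAt_fst hz).hasDerivAt.const_mul α).fun_add
      ((h.differentiableAt_snd hz).hasDerivAt.const_mul β)).deriv
  -- The rotated second coordinate vanishes at z, so the first alone carries the SU(2)-invariant
  -- quantities; likewise in `e2`.
  have e1 : z * deriv (fun z => α * p z + β * q z) z * conj (α * p z + β * q z) =
      z * deriv p z * conj (p z) + z * deriv q z * conj (q z) := by
    rw [hder]
    simp only [map_add, map_mul]
    linear_combination (z * deriv p z * conj (p z) + z * deriv q z * conj (q z)) * hN -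
      z * (-conj β * deriv p z + conj α * deriv q z) * h0c
  have e2 : ‖α * p z + β * q z‖ ^ 2 = ‖p z‖ ^ 2 + ‖q z‖ ^ 2 := by
    have : ((‖α * p z + β * q z‖ ^ 2 : ℝ) : ℂ) = ((‖p z‖ ^ 2 + ‖q z‖ ^ 2 : ℝ) : ℂ) := by
      push_cast
      rw [← Complex.mul_conj', ← Complex.mul_conj', ← Complex.mul_conj']
      simp only [map_add, map_mul]
      linear_combination (p z * conj (p z) + q z * conj (q z)) * hN -
        (-conj β * p z + conj α * q z) * h0c
    exact_mod_cast this
  rwa [e1, e2] at h1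

end ConvexLift
-- Homogeneous coordinates and the spherical derivative
/-- The point of the sphere with homogeneous coordinates `[y : x]`, that is, `y / x`. -/
def proj (x y : ℂ) : Sphere := if x = 0 then ∞ else ((y / x : ℂ) : Sphere)

theorem proj_eq_proj_iff {x y x' y' : ℂ} (h : x ≠ 0 ∨ y ≠ 0) (h' : x' ≠ 0 ∨ y' ≠ 0) :
    proj x y = proj x' y' ↔ x * y' = x' * y := by
  unfold proj
  split_ifs with hx hx' hx'
  · simp [hx, hx']
  · simp only [OnePoint.infty_ne_coe, false_iff, hx, zero_mul]
    exact (mul_ne_zero hx' (h.resolve_left (not_not.2 hx))).symm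
  · simp only [OnePoint.coe_ne_infty, false_iff, hx', zero_mul]
    exact mul_ne_zero hx (h'.resolve_left (not_not.2 hx'))
  · rw [OnePoint.coe_eq_coe, div_eq_div_iff hx hx']
    constructor <;> intro h <;> linear_combination -h

theorem stereoInv_proj {x y : ℂ} (h : x ≠ 0 ∨ y ≠ 0) :
    stereoInv (proj x y) = (((2 / (‖x‖ ^ 2 + ‖y‖ ^ 2) : ℝ) : ℂ) * (y * conj x),
      (‖y‖ ^ 2 - ‖x‖ ^ 2) / (‖x‖ ^ 2 + ‖y‖ ^ 2)) := by
  unfold proj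
  split_ifs with hx
  · have hy := h.resolve_left (not_not.2 hx)
    have : ‖y‖ ≠ 0 := norm_ne_zero_iff.2 hy
    simp only [stereoInv, OnePoint.elim_infty, hx, map_zero, mul_zero, norm_zero]
    refine Prod.ext rfl ?_
    field_simp
    ring
  · have hx0 : 0 < ‖x‖ := norm_pos_iff.2 hx
    have hpos : 0 < ‖x‖ ^ 2 + ‖y‖ ^ 2 := by positivity
    have hc : conj x ≠ 0 := by simpa using hx
    have h1 : 1 + ‖y / x‖ ^ 2 = (‖x‖ ^ 2 + ‖y‖ ^ 2) / ‖x‖ ^ 2 := by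
      rw [norm_div]
      field_simp
    simp only [stereoInv, OnePoint.elim_some]
    rw [h1]
    refine Prod.ext ?_ ?_
    · simp only
      have h2 : (((2 / ((‖x‖ ^ 2 + ‖y‖ ^ 2) / ‖x‖ ^ 2)) : ℝ) : ℂ) =
          ((2 / (‖x‖ ^ 2 + ‖y‖ ^ 2) : ℝ) : ℂ) * (x * conj x) := by
        rw [Complex.mul_conj']
        norm_cast
        field_simp
      rw [h2]
      field_simp
    · simp only [norm_div]
      field_simp

/-- The spherical derivative in homogeneous coordinates. -/
theorem sphDeriv_eq_of_lift {f : ℂ → Sphere} {p q : ℂ → ℂ} {z : ℂ} (hp : DifferentiableAt ℂ p z)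
    (hq : DifferentiableAt ℂ q z) (h0 : p z ≠ 0 ∨ q z ≠ 0)
    (hf : ∀ᶠ w in 𝓝 z, f w = proj (p w) (q w)) :
    sphDeriv f z = ‖p z * deriv q z - deriv p z * q z‖ / (‖p z‖ ^ 2 + ‖q z‖ ^ 2) := by
  have hfz := hf.self_of_nhds
  rcases eq_or_ne (p z) 0 with hpz | hpz
  · have hqz := h0.resolve_left (not_not.2 hpz)
    have hfz' : f z = ∞ := by rw [hfz, proj, if_pos hpz]
    have hev : (fun w => chartInfty (f w)) =ᶠ[𝓝 z] fun w => p w / q w := by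
      filter_upwards [hf] with w hw
      rw [hw, proj]
      split_ifs with h
      · simp [chartInfty, h]
      · simp [chartInfty]
    rw [sphDeriv, if_pos hfz', hev.deriv_eq, hev.eq_of_nhds,
      (hp.hasDerivAt.fun_div hq.hasDerivAt hqz).deriv]
    have : ‖q z‖ ≠ 0 := norm_ne_zero_iff.2 hqz
    rw [norm_div, norm_div, norm_pow, hpz, norm_zero, ← norm_neg (deriv p z * q z - _)]
    simp only [zero_mul, sub_zero, norm_neg, zero_sub]
    field_simp
    ring
  · have hfz' : f z ≠ ∞ := by
      rw [hfz, proj, if_neg hpz]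
      exact OnePoint.coe_ne_infty _
    have hev : (fun w => chartZero (f w)) =ᶠ[𝓝 z] fun w => q w / p w := by
      filter_upwards [hf, hp.continuousAt.eventually_ne hpz] with w hw hpw
      rw [hw, proj, if_neg hpw]
      simp [chartZero]
    rw [sphDeriv, if_neg hfz', hev.deriv_eq, hev.eq_of_nhds,
      (hq.hasDerivAt.fun_div hp.hasDerivAt hpz).deriv]
    have h1 : 0 < ‖p z‖ := norm_pos_iff.2 hpz
    rw [norm_div, norm_div, norm_pow, show p z * deriv q z - deriv p z * q z =
      deriv q z * p z - q z * deriv p z by ring]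
    field_simp

theorem proj_mul_left {c x y : ℂ} (hc : c ≠ 0) : proj (c * x) (c * y) = proj x y := by
  unfold proj
  simp only [mul_eq_zero, hc, false_or]
  rw [mul_div_mul_left _ _ hc]

/-! ### Construction of the lift -/

/-- A meromorphic map is holomorphic where it does not take the value `∞`. -/
theorem MeromorphicMapOn.differentiableAt_chartZero {f : ℂ → Sphere} {U : Set ℂ}
    (hf : MeromorphicMapOn f U) {z : ℂ} (hz : z ∈ U) (hfz : f z ≠ ∞) :
    DifferentiableAt ℂ (fun w => chartZero (f w)) z := by
  rcases hf z hz with ⟨g, hg, hfg⟩ | ⟨g, hg, -, hfg⟩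
  · refine hg.differentiableAt.congr_of_eventuallyEq ?_
    filter_upwards [hfg] with w hw
    simp [hw, chartZero]
  · have hgz : g z ≠ 0 := by
      intro h0
      exact hfz (by rw [hfg.self_of_nhds, h0, recip, if_pos rfl])
    refine (hg.differentiableAt.inv hgz).congr_of_eventuallyEq ?_
    filter_upwards [hfg, hg.continuousAt.eventually_ne hgz] with w hw hw0
    simp [hw, chartZero, recip, hw0]

/-- If `f` is meromorphic then `1 / (f - m)` is holomorphic where `f` does not take the
value `m`. -/
theorem MeromorphicMapOn.differentiableAt_inv_sub {f : ℂ → Sphere} {U : Set ℂ}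
    (hf : MeromorphicMapOn f U) {z : ℂ} (hz : z ∈ U) {m : ℂ} (hfz : f z ≠ (m : Sphere)) :
    DifferentiableAt ℂ (fun w => (f w).elim 0 (fun u => (u - m)⁻¹)) z := by
  rcases hf z hz with ⟨g, hg, hfg⟩ | ⟨g, hg, -, hfg⟩
  · have hgz : g z - m ≠ 0 := by
      intro h0
      exact hfz (by rw [hfg.self_of_nhds, sub_eq_zero.1 h0])
    refine ((hg.differentiableAt.sub_const m).inv hgz).congr_of_eventuallyEq ?_
    filter_upwards [hfg] with w hw
    simp [hw]
  · have hgz : 1 - m * g z ≠ 0 := by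
      intro h0
      have h1 : g z ≠ 0 := by
        intro h
        simp [h] at h0
      refine hfz ?_
      rw [hfg.self_of_nhds, recip, if_neg h1, OnePoint.coe_eq_coe]
      field_simp
      linear_combination h0
    have hd : DifferentiableAt ℂ (fun w => g w / (1 - m * g w)) z :=
      hg.differentiableAt.fun_div ((hg.differentiableAt.const_mul m).const_sub 1) hgz
    refine hd.congr_of_eventuallyEq ?_
    filter_upwards [hfg] with w hw
    rw [hw, recip]
    split_ifs with h
    · simp [h]
    · simp only [OnePoint.elim_some]
      rw [inv_eq_one_div, inv_eq_one_div, div_sub' h, one_div_div, mul_comm]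

/-- An injective meromorphic function on the disk is not onto the sphere. -/
theorem MeromorphicMapOn.image_ne_univ {f : ℂ → Sphere} (hf : MeromorphicMapOn f disk)
    (hinj : InjOn f disk) : f '' disk ≠ univ := by
  intro huniv
  obtain ⟨z₀, hz₀, hfz₀⟩ : (∞ : Sphere) ∈ f '' disk := huniv ▸ mem_univ _
  set U : Set ℂ := disk \ {z₀} with hUdef
  have hU : IsOpen U := Metric.isOpen_ball.sdiff isClosed_singleton
  set g : ℂ → ℂ := fun w => chartZero (f w) with hg
  have hne : ∀ w ∈ U, f w ≠ ∞ := fun w hw h => hw.2 (hinj hw.1 hz₀ (h.trans hfz₀.symm))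
  have hgd : DifferentiableOn ℂ g U := fun w hw =>
    (hf.differentiableAt_chartZero hw.1 (hne w hw)).differentiableWithinAt
  have hfg : ∀ w ∈ U, f w = ((g w : ℂ) : Sphere) := by
    intro w hw
    obtain ⟨u, hu⟩ := OnePoint.ne_infty_iff_exists.1 (hne w hw)
    simp [hg, ← hu, chartZero]
  have hginj : InjOn g U := fun a ha b hb hab =>
    hinj ha.1 hb.1 (by rw [hfg a ha, hfg b hb, hab])
  have hsurj : ∀ y : ℂ, ∃ w ∈ U, g w = y := by
    intro y
    obtain ⟨w, hw, hfw⟩ : (y : Sphere) ∈ f '' disk := huniv ▸ mem_univ _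
    have hwU : w ∈ U := ⟨hw, fun h => by
      rw [mem_singleton_iff.1 h, hfz₀] at hfw
      exact OnePoint.infty_ne_coe _ hfw⟩
    refine ⟨w, hwU, OnePoint.coe_eq_coe.1 ?_⟩
    rw [← hfg w hwU, hfw]
  -- If f were onto, then off its pole it would be a bijection onto ℂ, and its inverse a bounded
  -- nonconstant entire function, against Liouville.
  set G := Function.invFunOn g U with hG
  have hGd : Differentiable ℂ G := by
    intro y
    obtain ⟨w, hw, rfl⟩ := hsurj y
    exact (hasDerivAt_invFunOn hU hgd hginj hw).differentiableAt
  have hGb : Bornology.IsBounded (range G) := by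
    refine (Metric.isBounded_ball (x := (0 : ℂ)) (r := 1)).subset ?_
    rintro _ ⟨y, rfl⟩
    exact (Function.invFunOn_mem (hsurj y)).1
  have hconst := hGd.apply_eq_apply_of_bounded hGb 0 1
  have h0 : g (G 0) = 0 := Function.invFunOn_eq (hsurj 0)
  have h1 : g (G 1) = 1 := Function.invFunOn_eq (hsurj 1)
  rw [hconst, h1] at h0
  exact one_ne_zero h0

/-- Normalized homogeneous coordinates of an injective holomorphic function on the disk. -/
theorem exists_lift_of_injOn {g : ℂ → ℂ} (hg : DifferentiableOn ℂ g disk) (hinj : InjOn g disk) :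
    ∃ p : ℂ → ℂ, DifferentiableOn ℂ p disk ∧ (∀ z ∈ disk, p z ≠ 0) ∧
      ∀ z ∈ disk, p z * deriv (fun w => g w * p w) z - deriv p z * (g z * p z) = 1 := by
  have hU : IsOpen disk := Metric.isOpen_ball
  have hd : ∀ z ∈ disk, deriv g z ≠ 0 := fun z hz => deriv_ne_zero_of_injOn hU hg hinj hz
  -- With q = g p the Wronskian is p² g', so p must be a square root of 1 / g'.
  obtain ⟨p, hp, hp2⟩ := exists_sqrt ((hg.deriv hU).fun_inv hd) (fun z hz => inv_ne_zero (hd z hz))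
  refine ⟨p, hp, fun z hz h0 => ?_, fun z hz => ?_⟩
  · have := hp2 z hz
    rw [h0, zero_pow two_ne_zero] at this
    exact inv_ne_zero (hd z hz) this.symm
  · have h1 := (hg.differentiableAt (hU.mem_nhds hz)).hasDerivAt.fun_mul
      (hp.differentiableAt (hU.mem_nhds hz)).hasDerivAt
    rw [h1.deriv]
    have h2 := hp2 z hz
    have h3 : p z ^ 2 * deriv g z = 1 := by rw [h2, inv_mul_cancel₀ (hd z hz)]
    linear_combination h3

/-- Normalized homogeneous coordinates of an injective meromorphic function on the disk. -/
theorem MeromorphicMapOn.exists_lift {f : ℂ → Sphere} (hf : MeromorphicMapOn f disk)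
    (hinj : InjOn f disk) :
    ∃ p q : ℂ → ℂ, DifferentiableOn ℂ p disk ∧ DifferentiableOn ℂ q disk ∧
      (∀ z ∈ disk, p z * deriv q z - deriv p z * q z = 1) ∧
      ∀ z ∈ disk, f z = proj (p z) (q z) := by
  have hU : IsOpen disk := Metric.isOpen_ball
  obtain ⟨m, hm⟩ := (ne_univ_iff_exists_notMem _).1 (hf.image_ne_univ hinj)
  have hne : ∀ z ∈ disk, f z ≠ m := fun z hz h => hm ⟨z, hz, h⟩
  induction m using OnePoint.rec with
  | infty =>
    have hfg : ∀ z ∈ disk, f z = ((chartZero (f z) : ℂ) : Sphere) := by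
      intro z hz
      obtain ⟨u, hu⟩ := OnePoint.ne_infty_iff_exists.1 (hne z hz)
      simp [← hu, chartZero]
    have hg : DifferentiableOn ℂ (fun w => chartZero (f w)) disk := fun z hz =>
      (hf.differentiableAt_chartZero hz (hne z hz)).differentiableWithinAt
    obtain ⟨p, hp, hp0, hw⟩ := exists_lift_of_injOn hg (fun a ha b hb hab => hinj ha hb (by
      rw [hfg a ha, hfg b hb]
      exact congrArg _ hab))
    refine ⟨p, _, hp, hg.fun_mul hp, hw, fun z hz => ?_⟩
    rw [proj, if_neg (hp0 z hz), mul_div_cancel_right₀ _ (hp0 z hz)]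
    exact hfg z hz
  | coe m =>
    -- The default 0 at ∞ is the true value of 1 / (f - m) at a pole.
    set g : ℂ → ℂ := fun w => (f w).elim 0 (fun u => (u - m)⁻¹) with hgdef
    have hg : DifferentiableOn ℂ g disk := fun z hz =>
      (hf.differentiableAt_inv_sub hz (hne z hz)).differentiableWithinAt
    have hfg : ∀ z ∈ disk, f z = proj (g z) (m * g z + 1) := by
      intro z hz
      have h1 := hne z hz
      simp only [hgdef]
      induction hfz : f z using OnePoint.rec with
      | infty => simp [proj]
      | coe u =>
        have hum : u - m ≠ 0 := by
          intro h0
          exact h1 (by rw [hfz, sub_eq_zero.1 h0])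
        rw [OnePoint.elim_some, proj, if_neg (inv_ne_zero hum), OnePoint.coe_eq_coe]
        field_simp
        ring
    obtain ⟨p, hp, hp0, hw⟩ := exists_lift_of_injOn hg (fun a ha b hb hab => hinj ha hb (by
      rw [hfg a ha, hfg b hb, hab]))
    have hq := hg.fun_mul hp
    -- The pair (g p, m g p + p) has Wronskian -1; the factor i turns it into 1 and leaves the
    -- quotient unchanged.
    refine ⟨fun z => Complex.I * (g z * p z), fun z => Complex.I * (m * (g z * p z) + p z),
      hq.const_mul _, ((hq.const_mul m).fun_add hp).const_mul _, fun z hz => ?_, fun z hz => ?_⟩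
    · have h1 := (hq.differentiableAt (hU.mem_nhds hz)).hasDerivAt
      have h2 := (hp.differentiableAt (hU.mem_nhds hz)).hasDerivAt
      rw [(h1.const_mul Complex.I).deriv,
        (((h1.const_mul m).fun_add h2).const_mul Complex.I).deriv]
      linear_combination hw z hz - (p z * deriv (fun w => g w * p w) z -
        deriv p z * (g z * p z)) * Complex.I_sq
    · rw [proj_mul_left Complex.I_ne_zero, hfg z hz,
        show g z * p z = p z * g z by ring, show m * (p z * g z) + p z = p z * (m * g z + 1) by ring,
        proj_mul_left (hp0 z hz)]

/-- Directions with antipodal images are orthogonal. -/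
theorem inner_eq_zero_of_antipodal {x y x' y' : ℂ} (h : x ≠ 0 ∨ y ≠ 0) (h' : x' ≠ 0 ∨ y' ≠ 0)
    (ha : Antipodal (proj x y) (proj x' y')) : x * conj x' + y * conj y' = 0 := by
  have hN : ∀ {x y : ℂ}, x ≠ 0 ∨ y ≠ 0 → 0 < ‖x‖ ^ 2 + ‖y‖ ^ 2 := by
    rintro x y (h | h) <;> positivity
  have h1 := hN h
  have h2 := hN h'
  rw [Antipodal, stereoInv_proj h, stereoInv_proj h', Prod.neg_mk, Prod.mk.injEq] at ha
  obtain ⟨ha1, ha2⟩ := ha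
  set k : ℝ := (‖x'‖ ^ 2 + ‖y'‖ ^ 2) / (‖x‖ ^ 2 + ‖y‖ ^ 2) with hk
  have e1 : y' * conj x' = -k * (y * conj x) := by
    have h1' : ((‖x‖ : ℂ) ^ 2 + (‖y‖ : ℂ) ^ 2) ≠ 0 := by exact_mod_cast h1.ne'
    have h2' : ((‖x'‖ : ℂ) ^ 2 + (‖y'‖ : ℂ) ^ 2) ≠ 0 := by exact_mod_cast h2.ne'
    rw [hk]
    push_cast at ha1 ⊢
    field_simp at ha1 ⊢
    linear_combination ha1
  have e2 : ‖y'‖ ^ 2 = k * ‖x‖ ^ 2 := by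
    rw [hk]
    field_simp at ha2 ⊢
    linear_combination ha2 / 2
  have e3 : ‖x'‖ ^ 2 = k * ‖y‖ ^ 2 := by
    rw [hk]
    field_simp at ha2 ⊢
    linear_combination -ha2 / 2
  have e2' : y' * conj y' = k * (x * conj x) := by
    rw [Complex.mul_conj', Complex.mul_conj']
    exact_mod_cast e2
  have e3' : x' * conj x' = k * (y * conj y) := by
    rw [Complex.mul_conj', Complex.mul_conj']
    exact_mod_cast e3
  have e1' := congrArg conj e1
  simp only [map_mul, map_neg, Complex.conj_conj, Complex.conj_ofReal] at e1'
  -- The squared modulus of the Hermitian product is expressed through the two Hopf vectors; with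
  -- one equal to -k times the other, its terms cancel.
  have hz : (x * conj x' + y * conj y') * conj (x * conj x' + y * conj y') = 0 := by
    simp only [map_add, map_mul, Complex.conj_conj]
    linear_combination x * conj x * e3' + y * conj y * e2' + x * conj y * e1 + conj x * y * e1'
  exact (mul_eq_zero.1 hz).elim id (map_eq_zero (starRingEnd ℂ)).1

/-- The normalized homogeneous coordinates of a spherically convex function. -/
theorem IsSphericallyConvex.exists_convexLift {f : ℂ → Sphere} (hf : IsSphericallyConvex f) :
    ∃ p q : ℂ → ℂ, ConvexLift p q ∧ ∀ z ∈ disk, f z = proj (p z) (q z) := by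
  obtain ⟨p, q, hp, hq, hw, hfpq⟩ := hf.meromorphic.exists_lift hf.injOn
  have hne : ∀ z ∈ disk, p z ≠ 0 ∨ q z ≠ 0 := by
    intro z hz
    by_contra! hcon
    have := hw z hz
    simp [hcon.1, hcon.2] at this
  have hN : ∀ {x y : ℂ}, x ≠ 0 ∨ y ≠ 0 → 0 < ‖x‖ ^ 2 + ‖y‖ ^ 2 := by
    rintro x y (h | h) <;> positivity
  refine ⟨p, q, ⟨hp, hq, hw, fun a ha b hb hab => ?_, ?_, ?_⟩, hfpq⟩
  · refine hf.injOn ha hb ?_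
    rw [hfpq a ha, hfpq b hb, proj_eq_proj_iff (hne a ha) (hne b hb), hab]
  · intro a ha b hb hin x y s t hs ht hxy h1 h2
    have hanti : ¬ Antipodal (f a) (f b) := by
      rw [hfpq a ha, hfpq b hb]
      exact fun h => hin (inner_eq_zero_of_antipodal (hne a ha) (hne b hb) h)
    have hA := hN (hne a ha)
    have hB := hN (hne b hb)
    have hC := hN hxy
    have hmem : proj x y ∈ geodesicArc (f a) (f b) := by
      refine ⟨s * (‖p a‖ ^ 2 + ‖q a‖ ^ 2) / (‖x‖ ^ 2 + ‖y‖ ^ 2),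
        t * (‖p b‖ ^ 2 + ‖q b‖ ^ 2) / (‖x‖ ^ 2 + ‖y‖ ^ 2), by positivity, by positivity, ?_⟩
      rw [hfpq a ha, hfpq b hb, stereoInv_proj hxy, stereoInv_proj (hne a ha),
        stereoInv_proj (hne b hb)]
      simp only [Complex.mul_conj'] at h2
      have h2' : ‖y‖ ^ 2 - ‖x‖ ^ 2 = s * (‖q a‖ ^ 2 - ‖p a‖ ^ 2) + t * (‖q b‖ ^ 2 - ‖p b‖ ^ 2) := by
        exact_mod_cast h2
      refine Prod.ext ?_ ?_
      · simp only [Prod.smul_mk, Prod.mk_add_mk, Complex.real_smul]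
        rw [h1]
        have hA' : ((‖p a‖ : ℂ) ^ 2 + (‖q a‖ : ℂ) ^ 2) ≠ 0 := by exact_mod_cast hA.ne'
        have hB' : ((‖p b‖ : ℂ) ^ 2 + (‖q b‖ : ℂ) ^ 2) ≠ 0 := by exact_mod_cast hB.ne'
        have hC' : ((‖x‖ : ℂ) ^ 2 + (‖y‖ : ℂ) ^ 2) ≠ 0 := by exact_mod_cast hC.ne'
        push_cast
        field_simp
      · simp only [Prod.smul_mk, Prod.mk_add_mk, smul_eq_mul]
        rw [h2']
        field_simp
    obtain ⟨c, hc, hfc⟩ := hf.convex_image.geodesic_subset _ ⟨a, ha, rfl⟩ _ ⟨b, hb, rfl⟩ hanti hmem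
    refine ⟨c, hc, ?_⟩
    rw [hfpq c hc, proj_eq_proj_iff (hne c hc) hxy] at hfc
    rw [hfc, mul_comm]
  · obtain ⟨m, hm⟩ := (ne_univ_iff_exists_notMem _).1 (hf.meromorphic.image_ne_univ hf.injOn)
    obtain ⟨x, y, hxy, rfl⟩ : ∃ x y : ℂ, (x ≠ 0 ∨ y ≠ 0) ∧ m = proj x y := by
      induction m using OnePoint.rec with
      | infty => exact ⟨0, 1, by simp, by simp [proj]⟩
      | coe u => exact ⟨1, u, by simp, by simp [proj]⟩
    refine ⟨x, y, fun z hz heq => hm ⟨z, hz, ?_⟩⟩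
    rw [hfpq z hz, proj_eq_proj_iff (hne z hz) hxy, heq, mul_comm]

/-! ### Spherical isometries -/

/-- A Möbius transformation in homogeneous coordinates. -/
theorem smul_coe_eq_proj (M : GL (Fin 2) ℂ) (z : ℂ) :
    M • (z : Sphere) = proj (M 1 0 * z + M 1 1) (M 0 0 * z + M 0 1) :=
  OnePoint.smul_some_eq_ite

/-- Spherical isometries preserve the spherical metric. -/
theorem IsSphericalIsometry.sphDeriv_eq {f : ℂ → Sphere} (hf : IsSphericalIsometry f) {z : ℂ}
    (hz : z ∈ disk) : sphDeriv f z = 1 / (1 + ‖z‖ ^ 2) := by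
  obtain ⟨T, ⟨M, hM, hT⟩, hfT⟩ := hf
  have hev : ∀ᶠ w in 𝓝 z, f w = proj (M 1 0 * w + M 1 1) (M 0 0 * w + M 0 1) := by
    filter_upwards [Metric.isOpen_ball.mem_nhds hz] with w hw
    rw [hfT w hw, hT, smul_coe_eq_proj]
  have hder : ∀ A B : ℂ, HasDerivAt (fun w => A * w + B) A z := fun A B => by
    simpa using ((hasDerivAt_id' z).const_mul A).add_const B
  -- Each matrix is √N times a unitary one, with N the modulus of its determinant, so N cancels in
  -- the spherical derivative.
  have key : ∀ N : ℝ, 0 < N → ‖M 0 0 * M 1 1 - M 1 0 * M 0 1‖ = N →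
      ‖M 1 0 * z + M 1 1‖ ^ 2 + ‖M 0 0 * z + M 0 1‖ ^ 2 = N * (1 + ‖z‖ ^ 2) →
      sphDeriv f z = 1 / (1 + ‖z‖ ^ 2) := by
    intro N hN h1 h2
    have hpos : 0 < 1 + ‖z‖ ^ 2 := by positivity
    rw [sphDeriv_eq_of_lift (hder _ _).differentiableAt (hder _ _).differentiableAt ?_ hev,
      (hder _ _).deriv, (hder _ _).deriv, h2,
      show (M 1 0 * z + M 1 1) * M 0 0 - M 1 0 * (M 0 0 * z + M 0 1) =
        M 0 0 * M 1 1 - M 1 0 * M 0 1 by ring, h1]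
    · field_simp
    · by_contra! hcon
      rw [hcon.1, hcon.2] at h2
      simp only [norm_zero, ne_eq, OfNat.ofNat_ne_zero, not_false_eq_true, zero_pow,
        add_zero] at h2
      exact (mul_pos hN hpos).ne h2
  rcases hM with ⟨a, θ, hM⟩ | ⟨θ, hM⟩
  · have he := Complex.norm_exp_ofReal_mul_I θ
    set e := Complex.exp (θ * Complex.I)
    have h00 : M 0 0 = e := by rw [hM]; rfl
    have h01 : M 0 1 = -(e * a) := by rw [hM]; rfl
    have h10 : M 1 0 = conj a := by rw [hM]; rfl
    have h11 : M 1 1 = 1 := by rw [hM]; rfl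
    refine key (1 + ‖a‖ ^ 2) (by positivity) ?_ ?_
    · rw [h00, h01, h10, h11, show e * 1 - conj a * -(e * a) = e * (1 + conj a * a) by ring,
        norm_mul, he, one_mul, Complex.conj_mul']
      norm_cast
      rw [Real.norm_of_nonneg (by positivity)]
    · rw [h00, h01, h10, h11, show e * z + -(e * a) = e * (z - a) by ring, norm_mul, he, one_mul]
      have : ((‖conj a * z + 1‖ ^ 2 + ‖z - a‖ ^ 2 : ℝ) : ℂ) =
          (((1 + ‖a‖ ^ 2) * (1 + ‖z‖ ^ 2) : ℝ) : ℂ) := by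
        push_cast
        simp only [← Complex.mul_conj', map_add, map_sub, map_mul, Complex.conj_conj, map_one]
        ring
      exact_mod_cast this
  · have he := Complex.norm_exp_ofReal_mul_I θ
    set e := Complex.exp (θ * Complex.I)
    have h00 : M 0 0 = 0 := by rw [hM]; rfl
    have h01 : M 0 1 = e := by rw [hM]; rfl
    have h10 : M 1 0 = 1 := by rw [hM]; rfl
    have h11 : M 1 1 = 0 := by rw [hM]; rfl
    refine key 1 one_pos ?_ ?_
    · rw [h00, h01, h10, h11]
      simp [he]
    · rw [h00, h01, h10, h11]
      simp [he, add_comm]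

/-- Equality for spherical isometries. -/
theorem IsSphericalIsometry.lengthImage_eq {f : ℂ → Sphere} (hf : IsSphericalIsometry f) {r : ℝ}
    (hr0 : 0 < r) (hr1 : r < 1) : lengthImage f r = lengthCircle r * sphDeriv f 0 := by
  rw [hf.sphDeriv_eq (z := 0) (by simp), lengthImage, lengthCircle]
  simp only [norm_zero, ne_eq, OfNat.ofNat_ne_zero, not_false_eq_true, zero_pow, add_zero, div_one,
    mul_one]
  refine intervalIntegral.integral_congr fun t _ => ?_
  rw [hf.sphDeriv_eq (by simp [abs_of_pos hr0, hr1])]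

/-- A map with unitary homogeneous coordinates is a spherical isometry. -/
theorem isSphericalIsometry_of_unitary {f : ℂ → Sphere} {a b : ℂ}
    (h1 : ‖a‖ ^ 2 + ‖b‖ ^ 2 = 1)
    (hf : ∀ z ∈ disk, f z = proj (a - conj b * z) (b + conj a * z)) : IsSphericalIsometry f := by
  have hexp : ∀ u v : ℂ, ‖u‖ = ‖v‖ → v ≠ 0 →
      Complex.exp ((u / v).arg * Complex.I) = u / v := by
    intro u v huv hv
    have := Complex.norm_mul_exp_arg_mul_I (u / v)
    rwa [norm_div, huv, div_self (norm_ne_zero_iff.2 hv), Complex.ofReal_one, one_mul] at this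
  -- If a = 0 the map is (-b / b̄) / z. Otherwise dividing by a gives the normal form with centre -b
  -- / ā and unimodular factor ā / a.
  rcases eq_or_ne a 0 with rfl | ha
  · have hb : b ≠ 0 := by
      rintro rfl
      simp at h1
    have hcb : conj b ≠ 0 := by simpa using hb
    have he := hexp b (-conj b) (by simp) (neg_ne_zero.2 hcb)
    set θ := (b / -conj b).arg
    refine ⟨_, ⟨Matrix.GeneralLinearGroup.mkOfDetNeZero
      !![0, Complex.exp (θ * Complex.I); 1, 0] (by simp [Matrix.det_fin_two]),
      Or.inr ⟨θ, rfl⟩, fun p => rfl⟩, fun z hz => ?_⟩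
    rw [hf z hz, smul_coe_eq_proj]
    change _ = proj (1 * z + 0) (0 * z + Complex.exp (θ * Complex.I))
    rw [he]
    refine Eq.trans ?_ (proj_mul_left (c := -conj b) (neg_ne_zero.2 hcb))
    congr 1
    · ring
    · simp only [map_zero]
      field_simp
      ring
  · have hca : conj a ≠ 0 := by simpa using ha
    have he := hexp (conj a) a (by simp) ha
    set θ := (conj a / a).arg
    have hdet : (!![Complex.exp (θ * Complex.I), -(Complex.exp (θ * Complex.I) * (-b / conj a));
        conj (-b / conj a), 1] : Matrix (Fin 2) (Fin 2) ℂ).det ≠ 0 := by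
      rw [Matrix.det_fin_two_of]
      intro h0
      have h2 : Complex.exp (θ * Complex.I) * (1 + (-b / conj a) * conj (-b / conj a)) = 0 := by
        linear_combination h0
      rw [Complex.mul_conj'] at h2
      have h3 := (mul_eq_zero.1 h2).resolve_left (Complex.exp_ne_zero _)
      have h4 : (1 + ‖-b / conj a‖ ^ 2 : ℝ) = 0 := by exact_mod_cast h3
      have h5 : 0 < 1 + ‖-b / conj a‖ ^ 2 := by positivity
      exact h5.ne' h4
    refine ⟨_, ⟨Matrix.GeneralLinearGroup.mkOfDetNeZero _ hdet,
      Or.inl ⟨-b / conj a, θ, rfl⟩, fun p => rfl⟩, fun z hz => ?_⟩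
    rw [hf z hz, smul_coe_eq_proj]
    change _ = proj (conj (-b / conj a) * z + 1) (Complex.exp (θ * Complex.I) * z +
      -(Complex.exp (θ * Complex.I) * (-b / conj a)))
    rw [he]
    refine Eq.trans ?_ (proj_mul_left ha)
    congr 1
    · simp only [map_div₀, map_neg, Complex.conj_conj]
      field_simp
      ring
    · field_simp
      ring

/-! ### Coefficient inequalities -/

/-- If `∑ (1 - 2 n) c_n r^{2 n} ≥ 0` on `(0, 1)` with `c_n ≥ 0`, then
`∑_{n ≥ 1} (2 n - 1) c_n ≤ c_0`. -/
theorem sum_range_le_of_hasSum {c : ℕ → ℝ} (hc : ∀ n, 0 ≤ c n)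
    (h : ∀ r : ℝ, 0 < r → r < 1 →
      ∃ S, 0 ≤ S ∧ HasSum (fun n : ℕ => r ^ (2 * n) * ((1 - 2 * n) * c n)) S) (K : ℕ) :
    ∑ n ∈ Finset.range K, (2 * n + 1) * c (n + 1) ≤ c 0 := by
  have hr : ∀ r ∈ Ioo (0 : ℝ) 1,
      ∑ n ∈ Finset.range K, r ^ (2 * (n + 1)) * ((2 * n + 1) * c (n + 1)) ≤ c 0 := by
    rintro r ⟨hr0, hr1⟩
    obtain ⟨S, hS0, hS⟩ := h r hr0 hr1
    -- After negation only the n = 0 term is nonpositive, so the discarded tail is nonnegative.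
    -- Keeping finite sums lets r tend to 1 without interchanging limits.
    have h1 := sum_le_hasSum (Finset.range (K + 1)) (fun n hn => ?_) hS.neg
    · rw [Finset.sum_range_succ'] at h1
      have h2 : ∑ n ∈ Finset.range K, r ^ (2 * (n + 1)) * ((2 * n + 1) * c (n + 1)) =
          ∑ n ∈ Finset.range K,
            -(r ^ (2 * (n + 1)) * ((1 - 2 * ((n + 1 : ℕ) : ℝ)) * c (n + 1))) := by
        refine Finset.sum_congr rfl fun n _ => ?_
        push_cast
        ring
      rw [h2]
      simp only [mul_zero, pow_zero, Nat.cast_zero, sub_zero, one_mul] at h1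
      linarith
    · have hn1 : (1 : ℝ) ≤ n := by
        have : 1 ≤ n := by
          rw [Finset.mem_range] at hn
          omega
        exact_mod_cast this
      have := mul_nonneg (pow_nonneg hr0.le (2 * n))
        (mul_nonneg (by linarith : (0 : ℝ) ≤ 2 * n - 1) (hc n))
      linarith
  have hlim : Tendsto (fun r : ℝ =>
      ∑ n ∈ Finset.range K, r ^ (2 * (n + 1)) * ((2 * n + 1) * c (n + 1))) (𝓝[<] 1)
      (𝓝 (∑ n ∈ Finset.range K, (2 * n + 1) * c (n + 1))) := by
    have hcont : Continuous fun r : ℝ =>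
      ∑ n ∈ Finset.range K, r ^ (2 * (n + 1)) * ((2 * n + 1) * c (n + 1)) := by fun_prop
    simpa using (hcont.tendsto 1).mono_left nhdsWithin_le_nhds
  exact le_of_tendsto hlim (by filter_upwards [Ioo_mem_nhdsLT one_pos] with r hr' using hr r hr')

/-- Since r^{2(m+1)} ≤ r², replacing r^{2(m+1)} c_{m+1} by r² (2m + 1) c_{m+1} loses at least 2 m r²
c_{m+1} in each term. The case n = 0 is the bound on the mean; the cases n ≥ 1 retain one loss,
which must vanish when equality holds. -/
theorem hasSum_add_le {c : ℕ → ℝ} (hc : ∀ n, 0 ≤ c n)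
    (h : ∀ K, ∑ n ∈ Finset.range K, (2 * n + 1) * c (n + 1) ≤ c 0) {r M : ℝ} (hr0 : 0 < r)
    (hr1 : r < 1) (hM : HasSum (fun n => r ^ (2 * n) * c n) M) (n : ℕ) :
    M + 2 * n * r ^ 2 * c (n + 1) ≤ (1 + r ^ 2) * c 0 := by
  have hr2 : r ^ 2 ≤ 1 := pow_le_one₀ hr0.le hr1.le
  rw [← hasSum_nat_add_iff' 1] at hM
  simp only [Finset.range_one, Finset.sum_singleton, mul_zero, pow_zero, one_mul] at hM
  have hlim := hM.tendsto_sum_nat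
  have hle : ∀ᶠ K in atTop, ∑ m ∈ Finset.range K, r ^ (2 * (m + 1)) * c (m + 1) ≤
      r ^ 2 * c 0 - 2 * n * r ^ 2 * c (n + 1) := by
    filter_upwards [eventually_gt_atTop n] with K hK
    have hterm : ∀ m : ℕ, 2 * m * r ^ 2 * c (m + 1) ≤
        r ^ 2 * ((2 * m + 1) * c (m + 1)) - r ^ (2 * (m + 1)) * c (m + 1) := by
      intro m
      have h1 : r ^ (2 * (m + 1)) ≤ r ^ 2 := pow_le_pow_of_le_one hr0.le hr1.le (by omega)
      nlinarith [mul_le_mul_of_nonneg_right h1 (hc (m + 1))]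
    have h1 := Finset.single_le_sum (s := Finset.range K)
      (f := fun m : ℕ => r ^ 2 * ((2 * m + 1) * c (m + 1)) - r ^ (2 * (m + 1)) * c (m + 1))
      (fun m _ => le_trans (by have := hc (m + 1); positivity) (hterm m)) (Finset.mem_range.2 hK)
    rw [Finset.sum_sub_distrib, ← Finset.mul_sum] at h1
    have h2 := mul_le_mul_of_nonneg_left (h K) (sq_nonneg r)
    have h3 := hterm n
    linarith
  have := le_of_tendsto hlim hle
  linarith

namespace ConvexLift

variable {p q : ℂ → ℂ}

/-- The Taylor coefficients of a lift: mean values of `|p|² + |q|²` over circles, and the integrated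
curvature inequality. -/
theorem hasSum_circle (h : ConvexLift p q) {a b : ℕ → ℂ}
    (ha : ∀ z ∈ disk, HasSum (fun n => a n * z ^ n) (p z) ∧
      HasSum (fun n => (n * a n) * z ^ n) (z * deriv p z))
    (hb : ∀ z ∈ disk, HasSum (fun n => b n * z ^ n) (q z) ∧
      HasSum (fun n => (n * b n) * z ^ n) (z * deriv q z)) {r : ℝ} (hr0 : 0 < r) (hr1 : r < 1) :
    HasSum (fun n => r ^ (2 * n) * (‖a n‖ ^ 2 + ‖b n‖ ^ 2))
      ((2 * Real.pi)⁻¹ * ∫ t in (0 : ℝ)..(2 * Real.pi),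
        (‖p (circleMap 0 r t)‖ ^ 2 + ‖q (circleMap 0 r t)‖ ^ 2)) ∧
    ∃ S, 0 ≤ S ∧ HasSum (fun n : ℕ => r ^ (2 * n) * ((1 - 2 * n) * (‖a n‖ ^ 2 + ‖b n‖ ^ 2))) S := by
  have hpi : (2 * Real.pi) ≠ 0 := by positivity
  have hmem : ∀ t : ℝ, circleMap 0 r t ∈ disk := by
    intro t
    simp [abs_of_pos hr0, hr1]
  have hcirc := continuous_circleMap (0 : ℂ) r
  have hpc : Continuous fun t => p (circleMap 0 r t) :=
    h.diff_fst.continuousOn.comp_continuous hcirc hmem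
  have hqc : Continuous fun t => q (circleMap 0 r t) :=
    h.diff_snd.continuousOn.comp_continuous hcirc hmem
  have hpc' : Continuous fun t => deriv p (circleMap 0 r t) :=
    (h.diff_fst.deriv Metric.isOpen_ball).continuousOn.comp_continuous hcirc hmem
  have hqc' : Continuous fun t => deriv q (circleMap 0 r t) :=
    (h.diff_snd.deriv Metric.isOpen_ball).continuousOn.comp_continuous hcirc hmem
  have cP : Continuous fun t => p (circleMap 0 r t) * conj (p (circleMap 0 r t)) :=
    hpc.mul (Complex.continuous_conj.comp hpc)
  have cQ : Continuous fun t => q (circleMap 0 r t) * conj (q (circleMap 0 r t)) :=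
    hqc.mul (Complex.continuous_conj.comp hqc)
  have cP' : Continuous fun t => circleMap 0 r t * deriv p (circleMap 0 r t) *
      conj (p (circleMap 0 r t)) := (hcirc.mul hpc').mul (Complex.continuous_conj.comp hpc)
  have cQ' : Continuous fun t => circleMap 0 r t * deriv q (circleMap 0 r t) *
      conj (q (circleMap 0 r t)) := (hcirc.mul hqc').mul (Complex.continuous_conj.comp hqc)
  have cR : Continuous fun t => 2 *
      (circleMap 0 r t * deriv p (circleMap 0 r t) * conj (p (circleMap 0 r t)) +
        circleMap 0 r t * deriv q (circleMap 0 r t) * conj (q (circleMap 0 r t))).re :=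
    continuous_const.mul (Complex.continuous_re.comp (cP'.add cQ'))
  have cN : Continuous fun t => ‖p (circleMap 0 r t)‖ ^ 2 + ‖q (circleMap 0 r t)‖ ^ 2 :=
    (hpc.norm.pow 2).add (hqc.norm.pow 2)
  have hreal : ∀ {u : ℕ → ℂ} {F : ℝ → ℂ} {v : ℕ → ℝ}, Continuous F →
      HasSum (fun n => ((2 * Real.pi * r ^ (2 * n) : ℝ) : ℂ) * u n)
        (∫ t in (0 : ℝ)..(2 * Real.pi), F t) → (∀ n, (u n).re = v n) →
      HasSum (fun n => r ^ (2 * n) * v n)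
        ((2 * Real.pi)⁻¹ * ∫ t in (0 : ℝ)..(2 * Real.pi), (F t).re) := by
    intro u F v hF hu huv
    have h1 := (Complex.hasSum_re hu).mul_left (2 * Real.pi)⁻¹
    have h2 : (∫ t in (0 : ℝ)..(2 * Real.pi), F t).re =
        ∫ t in (0 : ℝ)..(2 * Real.pi), (F t).re :=
      (Complex.reCLM.intervalIntegral_comp_comm (hF.intervalIntegrable _ _)).symm
    rw [h2] at h1
    refine h1.congr_fun fun n => ?_
    rw [Complex.re_ofReal_mul, huv]
    field_simp
  have hM : HasSum (fun n => r ^ (2 * n) * (‖a n‖ ^ 2 + ‖b n‖ ^ 2))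
      ((2 * Real.pi)⁻¹ * ∫ t in (0 : ℝ)..(2 * Real.pi),
        (‖p (circleMap 0 r t)‖ ^ 2 + ‖q (circleMap 0 r t)‖ ^ 2)) := by
    have h1 := hasSum_integral_mul_conj (fun z hz => (ha z hz).1) (fun z hz => (ha z hz).1) hr0 hr1
      h.diff_fst.continuousOn
    have h2 := hasSum_integral_mul_conj (fun z hz => (hb z hz).1) (fun z hz => (hb z hz).1) hr0 hr1
      h.diff_snd.continuousOn
    have h3 := h1.add h2
    rw [← intervalIntegral.integral_add (cP.intervalIntegrable _ _)
      (cQ.intervalIntegrable _ _)] at h3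
    simp_rw [← mul_add] at h3
    have h4 := hreal (v := fun n => ‖a n‖ ^ 2 + ‖b n‖ ^ 2) (cP.fun_add cQ) h3 (fun n => by
      rw [Complex.mul_conj', Complex.mul_conj']
      norm_cast)
    convert h4 using 5 with t
    rw [Complex.mul_conj', Complex.mul_conj']
    norm_cast
  refine ⟨hM, ?_⟩
  have h1 := hasSum_integral_mul_conj (fun z hz => (ha z hz).2) (fun z hz => (ha z hz).1) hr0 hr1
    h.diff_fst.continuousOn
  have h2 := hasSum_integral_mul_conj (fun z hz => (hb z hz).2) (fun z hz => (hb z hz).1) hr0 hr1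
    h.diff_snd.continuousOn
  have h3 := h1.add h2
  rw [← intervalIntegral.integral_add
    (cP'.intervalIntegrable _ _) (cQ'.intervalIntegrable _ _)] at h3
  simp_rw [← mul_add] at h3
  have h4 := hreal (v := fun n => n * (‖a n‖ ^ 2 + ‖b n‖ ^ 2)) (cP'.fun_add cQ') h3 (fun n => by
    rw [mul_assoc, mul_assoc, Complex.mul_conj', Complex.mul_conj']
    norm_cast
    ring)
  have h5 := hM.sub (h4.mul_left 2)
  refine ⟨_, ?_, h5.congr_fun fun n => by ring⟩
  rw [mul_left_comm, ← mul_sub, ← intervalIntegral.integral_const_mul,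
    ← intervalIntegral.integral_sub (cN.intervalIntegrable _ _)
      (cR.intervalIntegrable _ _)]
  refine mul_nonneg (by positivity) (intervalIntegral.integral_nonneg (by positivity) fun t _ => ?_)
  exact sub_nonneg.2 (h.two_mul_re_le (hmem t))

/-- A lift with affine coordinates of constant norm on a circle is unitary up to a factor. -/
theorem eq_of_affine {a₀ a₁ b₀ b₁ : ℂ} (hw : a₀ * b₁ - a₁ * b₀ = 1)
    (hc : ‖a₁‖ ^ 2 + ‖b₁‖ ^ 2 = ‖a₀‖ ^ 2 + ‖b₀‖ ^ 2) (ho : a₁ * conj a₀ + b₁ * conj b₀ = 0) :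
    ‖a₀‖ ^ 2 + ‖b₀‖ ^ 2 = 1 ∧ a₁ = -conj b₀ ∧ b₁ = conj a₀ := by
  -- Cramer's rule for the determinant and orthogonality equations; comparing norms then forces N² =
  -- 1.
  have hb : b₁ * (a₀ * conj a₀ + b₀ * conj b₀) = conj a₀ := by
    linear_combination conj a₀ * hw + b₀ * ho
  have ha : a₁ * (a₀ * conj a₀ + b₀ * conj b₀) = -conj b₀ := by
    linear_combination -conj b₀ * hw + a₀ * ho
  set N : ℝ := ‖a₀‖ ^ 2 + ‖b₀‖ ^ 2 with hN
  have hNC : a₀ * conj a₀ + b₀ * conj b₀ = (N : ℂ) := by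
    rw [Complex.mul_conj', Complex.mul_conj', hN]
    norm_cast
  rw [hNC] at ha hb
  have hN0 : 0 ≤ N := by positivity
  have hna := congrArg norm ha
  have hnb := congrArg norm hb
  rw [norm_mul, norm_neg, RCLike.norm_conj, Complex.norm_real, Real.norm_of_nonneg hN0] at hna
  rw [norm_mul, RCLike.norm_conj, Complex.norm_real, Real.norm_of_nonneg hN0] at hnb
  have hN3 : N * N ^ 2 = N := by
    conv_rhs => rw [hN, ← hna, ← hnb]
    rw [← hc]
    ring
  have hNne : N ≠ 0 := by
    intro h0
    have h1 : ‖a₀‖ ^ 2 = 0 := by nlinarith [sq_nonneg ‖a₀‖, sq_nonneg ‖b₀‖]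
    have h2 : ‖b₀‖ ^ 2 = 0 := by nlinarith [sq_nonneg ‖a₀‖, sq_nonneg ‖b₀‖]
    have h3 : a₀ = 0 := by simpa using h1
    have h4 : b₀ = 0 := by simpa using h2
    simp [h3, h4] at hw
  have hN1 : N = 1 := by
    have : N ^ 2 = 1 := mul_left_cancel₀ hNne (by rw [hN3, mul_one])
    nlinarith
  rw [hN1] at ha hb
  exact ⟨hN1, by simpa using ha, by simpa using hb⟩

end ConvexLift

/-! ### Harmonic and arithmetic means, and the conclusion -/

/-- An integral form of the inequality between harmonic and arithmetic means, with the case of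
equality. -/
theorem two_pi_div_le_integral_inv {N : ℝ → ℝ} (hN : Continuous N) (hpos : ∀ t, 0 < N t) {μ : ℝ}
    (hμ : 0 < μ) (hM : (2 * Real.pi)⁻¹ * ∫ t in (0 : ℝ)..(2 * Real.pi), N t ≤ μ) :
    2 * Real.pi / μ ≤ ∫ t in (0 : ℝ)..(2 * Real.pi), 1 / N t ∧
    ((∫ t in (0 : ℝ)..(2 * Real.pi), 1 / N t) = 2 * Real.pi / μ →
      (2 * Real.pi)⁻¹ * (∫ t in (0 : ℝ)..(2 * Real.pi), N t) = μ ∧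
      ∀ t ∈ Icc 0 (2 * Real.pi), N t = μ) := by
  have hpi : 0 < 2 * Real.pi := by positivity
  have hc1 : Continuous fun t => 1 / N t := continuous_const.div hN fun t => (hpos t).ne'
  -- The gap between 1 / N and its tangent line at μ. Equality makes the integral of this
  -- nonnegative continuous function zero, so N is identically μ.
  have hD : ∀ t, (N t - μ) ^ 2 / (N t * μ ^ 2) = 1 / N t - (2 / μ - N t / μ ^ 2) := by
    intro t
    have := (hpos t).ne'
    field_simp
    ring
  have hcD : Continuous fun t => (N t - μ) ^ 2 / (N t * μ ^ 2) :=
    ((hN.sub continuous_const).pow 2).div (hN.mul continuous_const)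
      fun t => (mul_pos (hpos t) (by positivity)).ne'
  set I := ∫ t in (0 : ℝ)..(2 * Real.pi), 1 / N t with hI
  set J := ∫ t in (0 : ℝ)..(2 * Real.pi), N t with hJ
  have hint : ∫ t in (0 : ℝ)..(2 * Real.pi), (N t - μ) ^ 2 / (N t * μ ^ 2) =
      I - (2 * Real.pi * (2 / μ) - J / μ ^ 2) := by
    simp_rw [hD]
    rw [intervalIntegral.integral_sub (hc1.intervalIntegrable _ _)
      ((by fun_prop : Continuous _).intervalIntegrable _ _),
      intervalIntegral.integral_sub ((by fun_prop : Continuous _).intervalIntegrable _ _)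
      ((by fun_prop : Continuous _).intervalIntegrable _ _),
      intervalIntegral.integral_div (μ ^ 2) N, intervalIntegral.integral_const, sub_zero,
      smul_eq_mul]
  have hDnn : ∀ t, 0 ≤ (N t - μ) ^ 2 / (N t * μ ^ 2) := fun t => by
    have := hpos t
    positivity
  have hnn : 0 ≤ ∫ t in (0 : ℝ)..(2 * Real.pi), (N t - μ) ^ 2 / (N t * μ ^ 2) :=
    intervalIntegral.integral_nonneg hpi.le fun t _ => hDnn t
  have hJle : J ≤ 2 * Real.pi * μ := by
    rw [inv_mul_le_iff₀ hpi] at hM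
    exact hM
  have hJle' : J / μ ^ 2 ≤ 2 * Real.pi / μ := by
    rw [div_le_div_iff₀ (by positivity) hμ]
    nlinarith [mul_le_mul_of_nonneg_right hJle hμ.le]
  have h2 : 2 * Real.pi * (2 / μ) = 2 * Real.pi / μ + 2 * Real.pi / μ := by ring
  refine ⟨by linarith, fun heq => ⟨?_, fun t ht => ?_⟩⟩
  · have h3 : J / μ ^ 2 = 2 * Real.pi / μ := by linarith
    rw [div_eq_div_iff (by positivity) hμ.ne'] at h3
    have h4 : J = 2 * Real.pi * μ := mul_right_cancel₀ hμ.ne' (by rw [h3]; ring)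
    rw [h4]
    field_simp
  · by_contra hne
    have hlt := intervalIntegral.integral_pos hpi hcD.continuousOn (fun t _ => hDnn t)
      ⟨t, ht, div_pos (sq_pos_of_ne_zero (sub_ne_zero.2 hne))
        (mul_pos (hpos t) (by positivity))⟩
    linarith

/-- **Length Schwarz lemma** for spherically convex functions, with the case of equality. -/
theorem IsSphericallyConvex.lengthCircle_mul_le {f : ℂ → Sphere} (hf : IsSphericallyConvex f)
    {r : ℝ} (hr0 : 0 < r) (hr1 : r < 1) :
    lengthCircle r * sphDeriv f 0 ≤ lengthImage f r ∧
      (lengthImage f r = lengthCircle r * sphDeriv f 0 → IsSphericalIsometry f) := by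
  obtain ⟨p, q, h, hfpq⟩ := hf.exists_convexLift
  have hU : IsOpen disk := Metric.isOpen_ball
  have h0 : (0 : ℂ) ∈ disk := by simp
  have hmem : ∀ t : ℝ, circleMap 0 r t ∈ disk := by
    intro t
    simp [abs_of_pos hr0, hr1]
  have hsph : ∀ z ∈ disk, sphDeriv f z = 1 / (‖p z‖ ^ 2 + ‖q z‖ ^ 2) := by
    intro z hz
    rw [sphDeriv_eq_of_lift (h.differentiableAt_fst hz) (h.differentiableAt_snd hz) ?_ ?_,
      h.wronskian z hz, norm_one]
    · by_contra! hcon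
      have := h.norm_sq_pos hz
      simp [hcon.1, hcon.2] at this
    · filter_upwards [hU.mem_nhds hz] with w hw using hfpq w hw
  obtain ⟨a, ha⟩ := exists_hasSum_pow h.diff_fst
  obtain ⟨b, hb⟩ := exists_hasSum_pow h.diff_snd
  have ha0 : p 0 = a 0 := by
    refine (ha 0 h0).1.unique ?_
    simpa using hasSum_single (f := fun n => a n * (0 : ℂ) ^ n) 0 (fun n hn => by simp [hn])
  have hb0 : q 0 = b 0 := by
    refine (hb 0 h0).1.unique ?_
    simpa using hasSum_single (f := fun n => b n * (0 : ℂ) ^ n) 0 (fun n hn => by simp [hn])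
  set c : ℕ → ℝ := fun n => ‖a n‖ ^ 2 + ‖b n‖ ^ 2 with hc
  have hcnn : ∀ n, 0 ≤ c n := fun n => by positivity
  have hc0 : 0 < c 0 := by
    have := h.norm_sq_pos h0
    rwa [ha0, hb0] at this
  have hsum := sum_range_le_of_hasSum hcnn fun s hs0 hs1 => (h.hasSum_circle ha hb hs0 hs1).2
  have hM := (h.hasSum_circle ha hb hr0 hr1).1
  set N : ℝ → ℝ := fun t => ‖p (circleMap 0 r t)‖ ^ 2 + ‖q (circleMap 0 r t)‖ ^ 2 with hNdef
  have hle := hasSum_add_le hcnn hsum hr0 hr1 hM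
  have hNc : Continuous N := by
    have hcirc := continuous_circleMap (0 : ℂ) r
    exact ((h.diff_fst.continuousOn.comp_continuous hcirc hmem).norm.pow 2).add
      ((h.diff_snd.continuousOn.comp_continuous hcirc hmem).norm.pow 2)
  have hNpos : ∀ t, 0 < N t := fun t => h.norm_sq_pos (hmem t)
  obtain ⟨hmain, heq⟩ := two_pi_div_le_integral_inv hNc hNpos (μ := (1 + r ^ 2) * c 0)
    (by positivity) (by simpa using hle 0)
  have hlen : lengthImage f r = (∫ t in (0 : ℝ)..(2 * Real.pi), 1 / N t) * r := by
    rw [lengthImage, intervalIntegral.integral_mul_const]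
    congr 1
    exact intervalIntegral.integral_congr fun t _ => hsph _ (hmem t)
  have hlen0 : lengthCircle r * sphDeriv f 0 = 2 * Real.pi / ((1 + r ^ 2) * c 0) * r := by
    rw [lengthCircle_eq, hsph 0 h0, ha0, hb0, show ‖a 0‖ ^ 2 + ‖b 0‖ ^ 2 = c 0 from rfl]
    field_simp
  rw [hlen, hlen0]
  refine ⟨mul_le_mul_of_nonneg_right hmain hr0.le, fun hE => ?_⟩
  obtain ⟨hMeq, hNeq⟩ := heq (mul_right_cancel₀ hr0.ne' hE)
  rw [hMeq] at hle hM
  -- The mean now equals (1 + r²) c_0, so no loss is allowed in `hle` at index m + 1 ≥ 1.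
  have hcn : ∀ n, n ∉ Finset.range 2 → c n = 0 := by
    intro n hn
    obtain ⟨m, rfl⟩ : ∃ m, n = m + 2 := ⟨n - 2, by simp at hn; omega⟩
    have h1 := hle (m + 1)
    have h2 : 0 < 2 * ((m + 1 : ℕ) : ℝ) * r ^ 2 := by positivity
    have h3 : c (m + 1 + 1) ≤ 0 := by
      by_contra hcon
      push Not at hcon
      have := mul_pos h2 hcon
      linarith
    exact le_antisymm h3 (hcnn _)
  have han : ∀ n, n ∉ Finset.range 2 → a n = 0 := by
    intro n hn
    have h1 := hcn n hn
    have h2 : ‖a n‖ ^ 2 = 0 := by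
      simp only [hc] at h1
      linarith [sq_nonneg ‖a n‖, sq_nonneg ‖b n‖]
    simpa using h2
  have hbn : ∀ n, n ∉ Finset.range 2 → b n = 0 := by
    intro n hn
    have h1 := hcn n hn
    have h2 : ‖b n‖ ^ 2 = 0 := by
      simp only [hc] at h1
      linarith [sq_nonneg ‖a n‖, sq_nonneg ‖b n‖]
    simpa using h2
  have hp : ∀ z ∈ disk, p z = a 0 + a 1 * z := by
    intro z hz
    refine ((ha z hz).1.unique (hasSum_sum_of_ne_finset_zero (s := Finset.range 2)
      fun n hn => by rw [han n hn, zero_mul])).trans ?_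
    simp [Finset.sum_range_succ]
  have hq : ∀ z ∈ disk, q z = b 0 + b 1 * z := by
    intro z hz
    refine ((hb z hz).1.unique (hasSum_sum_of_ne_finset_zero (s := Finset.range 2)
      fun n hn => by rw [hbn n hn, zero_mul])).trans ?_
    simp [Finset.sum_range_succ]
  have hder : ∀ {g : ℂ → ℂ} {u v : ℂ}, (∀ z ∈ disk, g z = u + v * z) → deriv g 0 = v := by
    intro g u v hg
    have hev : g =ᶠ[𝓝 0] fun z => u + v * z := by
      filter_upwards [hU.mem_nhds h0] with z hz using hg z hz
    rw [hev.deriv_eq]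
    simp
  have hw := h.wronskian 0 h0
  rw [hder hp, hder hq, ha0, hb0] at hw
  have hc1 : c 1 = c 0 := by
    have h1 := hM.unique (hasSum_sum_of_ne_finset_zero (s := Finset.range 2)
      fun n hn => mul_eq_zero_of_right _ (hcn n hn))
    rw [Finset.sum_range_succ, Finset.sum_range_one] at h1
    simp only [mul_zero, pow_zero, one_mul, mul_one] at h1
    have h2 : r ^ 2 * c 1 = r ^ 2 * c 0 := by linarith
    exact mul_left_cancel₀ (by positivity) h2
  -- On |z| = r, N = c_0 + c_1 r² + 2 Re (z e) for the affine lift. Constancy of N kills Re (z e),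
  -- and z = r, z = i r give e = 0.
  set e := a 1 * conj (a 0) + b 1 * conj (b 0) with he
  have hre : ∀ t ∈ Icc 0 (2 * Real.pi), (circleMap 0 r t * e).re = 0 := by
    intro t ht
    have h1 := hNeq t ht
    have hz : ‖circleMap 0 r t‖ ^ 2 = r ^ 2 := by simp
    simp only [hNdef] at h1
    rw [hp _ (hmem t), hq _ (hmem t)] at h1
    set z := circleMap 0 r t
    have h2 : ‖a 0 + a 1 * z‖ ^ 2 + ‖b 0 + b 1 * z‖ ^ 2 =
        c 0 + c 1 * ‖z‖ ^ 2 + 2 * (z * e).re := by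
      simp only [hc, he, ← Complex.normSq_eq_norm_sq, Complex.normSq_apply, Complex.add_re,
        Complex.add_im, Complex.mul_re, Complex.mul_im, Complex.conj_re, Complex.conj_im]
      ring
    rw [h2, hz, hc1] at h1
    linarith
  have hpi := Real.pi_pos
  have he0 : e = 0 := by
    have h1 := hre 0 ⟨le_rfl, by positivity⟩
    have h2 := hre (Real.pi / 2) ⟨by positivity, by linarith⟩
    refine Complex.ext ?_ ?_
    · simpa [circleMap_zero, hr0.ne'] using h1
    · rw [circleMap_zero] at h2
      push_cast at h2
      rw [Complex.exp_pi_div_two_mul_I, mul_assoc, Complex.re_ofReal_mul] at h2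
      simpa [hr0.ne'] using h2
  obtain ⟨hN1, ha1, hb1⟩ := ConvexLift.eq_of_affine hw hc1 he0
  refine isSphericalIsometry_of_unitary hN1 fun z hz => ?_
  rw [hfpq z hz, hp z hz, hq z hz, ha1, hb1, neg_mul, sub_eq_add_neg]

end SphGeom
end

theorem mainTheorem3 (f : ℂ → SphGeom.Sphere) (hf : SphGeom.IsSphericallyConvex f) :
    (∀ r : ℝ, 0 < r → r < 1 →
      SphGeom.lengthCircle r * SphGeom.sphDeriv f 0 ≤ SphGeom.lengthImage f r) ∧
    (∀ r : ℝ, 0 < r → r < 1 →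
      (SphGeom.lengthImage f r = SphGeom.lengthCircle r * SphGeom.sphDeriv f 0 ↔
        SphGeom.IsSphericalIsometry f)) :=
  ⟨fun _ hr0 hr1 => (hf.lengthCircle_mul_le hr0 hr1).1, fun _ hr0 hr1 =>
    ⟨(hf.lengthCircle_mul_le hr0 hr1).2, fun h => h.lengthImage_eq hr0 hr1⟩⟩
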